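/- Let $X\in\mathbb{R}^{n\times p}$ be a data matrix and let $Y\in\{0,1\}^{n\times K}$ be the class-indicator matrix of $n$ observations that each belong to exactly one of $K$ nonempty classes ($Y_{ij}=1$ if observation $i$ belongs to class $j$, and $Y_{ij}=0$ otherwise). Let $\gamma>0$, $\lambda>0$, let $q\ge 0$ be an integer, put $L=\frac{1}{\sqrt n}Y$, and for $\theta\in\mathbb{R}^{K\times q}$, $\beta\in\mathbb{R}^{p\times q}$ let $$J(\theta,\beta)=\|Y\theta-X\beta\|_F^2+\gamma\|\beta\|_F^2+\lambda\|\beta\|_1,$$ where $\|\beta\|_1=\sum_{i,j}|\beta_{ij}|$. For a penalty parameter $\rho>0$ and a scaled multiplier $B\in\mathbb{R}^{n\times q}$, the augmented Lagrangian of the problem of minimizing $J(\theta,\beta)$ subject to $P=L\theta$ and $P^TP=I$ is $$\mathcal{L}_\rho(\theta,\beta,P;B)=J(\theta,\beta)+\rho\,\langle B,\,L\theta-P\rangle+\tfrac{\rho}{2}\|L\theta-P\|_F^2+\iota(P),\qquad \iota(P)=\begin{cases}0,&P^TP=I,\\+\infty,&\text{otherwise.}\end{cases}$$ The DFSOS algorithm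 with penalty parameter $\rho$ starts from some $\theta^0$ with $\frac1n(\theta^0)^TY^TY\theta^0=I$ and an arbitrary $\beta^0$, sets $P^0=L\theta^0$ and $B^0=0$, and for $k=1,2,\dots$: 1. takes $(\theta^k,\beta^k)$ to be a minimizer over $(\theta,\beta)$ of $J(\theta,\beta)+\frac{\rho}{2}\|L\theta-P^{k-1}+B^{k-1}\|_F^2$; 2. takes a singular value decomposition $L\theta^k+B^{k-1}=UDV^T$ and sets $P^k=U I_{n\times q}V^T$, where $I_{n\times q}$ has ones on its main diagonal and zeros elsewhere; 3. sets $B^k=B^{k-1}+L\theta^k-P^k$. Let $\partial\mathcal{L}_\rho(\theta,\beta,P;B)$ denote the limiting (Mordukhovich) subdifferential of $\mathcal{L}_\rho(\cdot,\cdot,\cdot\,;B)$ at $(\theta,\beta,P)$, and call $(\theta,\beta,P,B)$ stationary if $P=L\theta$ and $0\in\partial\mathcal{L}_\rho(\theta,\beta,P;B)$. **Theorem.** There is $\rho_0>0$, depending only on $X$, $Y$, $q$, $\gamma$ and $\lambda$, such that for every $\rho\ge\rho_0$ and every sequence $(\theta^k,\beta^k,P^k,B^k)_{k\ge 0}$ generated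 by the DFSOS algorithm with penalty parameter $\rho$: - (convergence) the distance from $(\theta^k,\beta^k,P^k,B^k)$ to the set of stationary points tends to $0$, the objective values $J(\theta^k,\beta^k)$ converge to a real number, $\|L\theta^k-P^k\|_F\to0$, and $\|(\theta^{k+1},\beta^{k+1},P^{k+1},B^{k+1})-(\theta^k,\beta^k,P^k,B^k)\|\to 0$; - the sequence $(\theta^k,\beta^k)$ is bounded and has at least one limit point; - every limit point $(\theta^*,\beta^*)$ of $(\theta^k,\beta^k)$ is a stationary point of the augmented Lagrangian: whenever $(\theta^{k_j},\beta^{k_j})\to(\theta^*,\beta^*)$ along a subsequence, $P^{k_j}$ and $B^{k_j}$ converge to some $P^*$ and $B^*$ such that $P^*=L\theta^*$ and $0\in\partial\mathcal{L}_\rho(\theta^*,\beta^*,P^*;B^*)$. -/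

import Mathlib

open Filter Topology

-- `‖A‖` is the Frobenius norm of a real matrix throughout.
attribute [local instance] Matrix.frobeniusNormedAddCommGroup Matrix.frobeniusNormedSpace

noncomputable section

/-! ### Subdifferentials of extended-real-valued functions -/

/-- The regular (Fréchet) subdifferential of `f : E → [-∞, ∞]` at `x`: `f x` is finite and
`f x' ≥ f x + v (x' - x) - o(‖x' - x‖)` as `x' → x`. It is empty where `f` is not finite. -/
def regularSubdifferential {E : Type*} [NormedAddCommGroup E] [NormedSpace ℝ E]
    (f : E → EReal) (x : E) : Set (E →L[ℝ] ℝ) :=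
  {v | f x ≠ ⊤ ∧ f x ≠ ⊥ ∧
    ∀ ε : ℝ, 0 < ε → ∀ᶠ x' in 𝓝 x, f x + ((v (x' - x) - ε * ‖x' - x‖ : ℝ) : EReal) ≤ f x'}

/-- The general (limiting, Mordukhovich) subdifferential of `f : E → [-∞, ∞]` at `x`: limits of
regular subgradients `v j` at points `y j → x` with `f (y j) → f x`, where `f x` is finite. -/
def limitingSubdifferential {E : Type*} [NormedAddCommGroup E] [NormedSpace ℝ E]
    (f : E → EReal) (x : E) : Set (E →L[ℝ] ℝ) :=
  {v | f x ≠ ⊤ ∧ f x ≠ ⊥ ∧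
    ∃ (y : ℕ → E) (w : ℕ → (E →L[ℝ] ℝ)),
      Tendsto y atTop (𝓝 x) ∧ Tendsto (fun j => f (y j)) atTop (𝓝 (f x)) ∧
      (∀ j, w j ∈ regularSubdifferential f (y j)) ∧ Tendsto w atTop (𝓝 v)}

namespace DFSOS

variable {n K p q : ℕ}

/-! ### The deflation-free sparse optimal scoring problem -/

/-- The `n × K` class indicator matrix `Y` of the class labels `c`. -/
def indicatorMatrix (c : Fin n → Fin K) : Matrix (Fin n) (Fin K) ℝ :=
  Matrix.of fun i j => if c i = j then 1 else 0

/-- `L = Y / √n`. -/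
def scaledIndicator (c : Fin n → Fin K) : Matrix (Fin n) (Fin K) ℝ :=
  (1 / Real.sqrt (n : ℝ)) • indicatorMatrix c

/-- The objective `J(θ, β) = ‖Yθ - Xβ‖_F² + γ ‖β‖_F² + lam ‖β‖₁`, with the entrywise `ℓ₁` norm. -/
def objective (c : Fin n → Fin K) (X : Matrix (Fin n) (Fin p) ℝ) (γ lam : ℝ)
    (θ : Matrix (Fin K) (Fin q) ℝ) (β : Matrix (Fin p) (Fin q) ℝ) : ℝ :=
  ‖indicatorMatrix c * θ - X * β‖ ^ 2 + γ * ‖β‖ ^ 2 + lam * ∑ i, ∑ j, |β i j|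

open Classical in
/-- The augmented Lagrangian, as a function of the primal variables `(θ, β, P)`, of the problem
of minimizing `J(θ, β)` subject to `P = Lθ` and `Pᵀ P = I`, with penalty parameter `ρ` and
scaled multiplier `B` (so that the multiplier of `Lθ - P = 0` is `ρ B`):
`J(θ, β) + ⟨ρ B, Lθ - P⟩ + (ρ / 2) ‖Lθ - P‖_F²`, plus the indicator function of `Pᵀ P = I`. -/
def augmentedLagrangian (c : Fin n → Fin K) (X : Matrix (Fin n) (Fin p) ℝ) (γ lam ρ : ℝ)
    (B : Matrix (Fin n) (Fin q) ℝ)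
    (z : Matrix (Fin K) (Fin q) ℝ × Matrix (Fin p) (Fin q) ℝ × Matrix (Fin n) (Fin q) ℝ) :
    EReal :=
  if z.2.2.transpose * z.2.2 = 1 then
    ((objective c X γ lam z.1 z.2.1
      + ρ * (B.transpose * (scaledIndicator c * z.1 - z.2.2)).trace
      + ρ / 2 * ‖scaledIndicator c * z.1 - z.2.2‖ ^ 2 : ℝ) : EReal)
  else ⊤

/-- The stationary points `(θ, β, P, B)` of the augmented Lagrangian: `P = Lθ` (stationarity in
the multiplier) and `0 ∈ ∂𝓛(θ, β, P)` for the multiplier `B`. -/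
def stationarySet (c : Fin n → Fin K) (X : Matrix (Fin n) (Fin p) ℝ) (q : ℕ) (γ lam ρ : ℝ) :
    Set (Matrix (Fin K) (Fin q) ℝ × Matrix (Fin p) (Fin q) ℝ ×
      Matrix (Fin n) (Fin q) ℝ × Matrix (Fin n) (Fin q) ℝ) :=
  {w | w.2.2.1 = scaledIndicator c * w.1 ∧
    0 ∈ limitingSubdifferential (augmentedLagrangian c X γ lam ρ w.2.2.2)
      (w.1, w.2.1, w.2.2.1)}

/-! ### The algorithm -/

/-- The `n × q` matrix with ones on the main diagonal and zeros elsewhere. -/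
def rectIdentity (n q : ℕ) : Matrix (Fin n) (Fin q) ℝ :=
  Matrix.of fun i j => if (i : ℕ) = (j : ℕ) then 1 else 0

/-- `M = U D Vᵀ` is a singular value decomposition: `U`, `V` orthogonal and `D` rectangular
diagonal with nonnegative entries. (No order of the singular values is imposed.) -/
def IsSVD (M : Matrix (Fin n) (Fin q) ℝ) (U : Matrix (Fin n) (Fin n) ℝ)
    (D : Matrix (Fin n) (Fin q) ℝ) (V : Matrix (Fin q) (Fin q) ℝ) : Prop :=
  U ∈ Matrix.orthogonalGroup (Fin n) ℝ ∧ V ∈ Matrix.orthogonalGroup (Fin q) ℝ ∧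
    (∀ (i : Fin n) (j : Fin q), (i : ℕ) ≠ (j : ℕ) → D i j = 0) ∧ (∀ i j, 0 ≤ D i j) ∧ M = U * D * V.transpose

/-- `(θ k, β k, P k, B k)`, `k = 0, 1, 2, …`, is generated by the DFSOS algorithm with data
`X`, class labels `c`, regularization parameters `γ`, `lam` and penalty parameter `ρ`. -/
structure IsSequence (c : Fin n → Fin K) (X : Matrix (Fin n) (Fin p) ℝ) (γ lam ρ : ℝ)
    (θ : ℕ → Matrix (Fin K) (Fin q) ℝ) (β : ℕ → Matrix (Fin p) (Fin q) ℝ)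
    (P B : ℕ → Matrix (Fin n) (Fin q) ℝ) : Prop where
  /-- The initial scores are feasible: `(1 / n) (θ 0)ᵀ Yᵀ Y (θ 0) = I`. -/
  init_feasible : (1 / (n : ℝ)) •
    ((θ 0).transpose * (indicatorMatrix c).transpose * indicatorMatrix c * θ 0) = 1
  init_P : P 0 = scaledIndicator c * θ 0
  init_B : B 0 = 0
  /-- `(θ (k+1), β (k+1))` minimizes `J(θ, β) + (ρ / 2) ‖Lθ - P k + B k‖_F²`. -/
  scores_step : ∀ k, IsMinOn
    (fun z : Matrix (Fin K) (Fin q) ℝ × Matrix (Fin p) (Fin q) ℝ =>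
      objective c X γ lam z.1 z.2 + ρ / 2 * ‖scaledIndicator c * z.1 - P k + B k‖ ^ 2)
    Set.univ (θ (k + 1), β (k + 1))
  P_step : ∀ k, ∃ U D V, IsSVD (scaledIndicator c * θ (k + 1) + B k) U D V ∧
    P (k + 1) = U * rectIdentity n q * V.transpose
  B_step : ∀ k, B (k + 1) = B k + scaledIndicator c * θ (k + 1) - P (k + 1)

end DFSOS

end

/-! The argument is a Lyapunov argument for nonconvex ADMM: the augmented Lagrangian decreases in
both primal steps and increases by `ρ‖ΔB‖²` in the multiplier step, so everything rests on bounding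
the multiplier change by primal changes with a factor of order `1/ρ`.

Two facts give this bound. First, `P` and `B` stay in the range of `L`. The scores step could thus
reach residual `R = Lθ + B - P` equal to zero with `β = 0`, so `J + (ρ/2)‖R‖²` is bounded
independently of `ρ` and `R` is small. Nonempty classes make `LᵀL` invertible, and the optimality
condition in `θ` then expresses `R` as `1/ρ` times a fixed linear function of `Yθ - Xβ`. Second, the
SVD step is the polar factorization `P + R = P'(1 + S)`, whence `B' = P'S` and `‖B'‖ = ‖S‖ ≤ ‖R‖`.
For small `S` the factor is Lipschitz in the Gram matrix `(1 + S)²`, on which a change of `P` acts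
only through terms containing `R`. See `IsAdmissible.update`, `IsUpdate.norm_sub_le` and
`IsSequence.norm_B_sub_le`.

For large `ρ` the increase is absorbed, after half the last squared change of `P` is added to the
Lagrangian (`IsSequence.tendsto_sub_zero`). Successive differences vanish, and optimality of the
scores step, orthonormality of `P` and the form `B = PS` with `S` symmetric pass to limit points.
These yield stationarity: `J` is convex, and `PS` is normal to the Stiefel manifold at `P`
(`zero_mem_limitingSubdifferential`). -/

open scoped Matrix

namespace DFSOS

/-! ### Frobenius geometry of orthonormal frames -/

section FrobeniusInner

variable {l m r : Type*} [Fintype l] [Fintype m] [Fintype r]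

/-- The Frobenius inner product of two real matrices. -/
noncomputable def frobeniusInner (A B : Matrix m l ℝ) : ℝ := (Aᵀ * B).trace

theorem frobeniusInner_eq_sum (A B : Matrix m l ℝ) :
    frobeniusInner A B = ∑ j, ∑ i, A i j * B i j := by
  simp [frobeniusInner, Matrix.trace, Matrix.mul_apply]

theorem frobeniusInner_self (A : Matrix m l ℝ) : frobeniusInner A A = ‖A‖ ^ 2 := by
  rw [frobeniusInner_eq_sum, Matrix.frobenius_norm_def, ← Real.sqrt_eq_rpow, Real.sq_sqrt
    (by positivity), Finset.sum_comm]
  simp [pow_two]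

theorem frobeniusInner_comm (A B : Matrix m l ℝ) : frobeniusInner A B = frobeniusInner B A := by
  simp [frobeniusInner_eq_sum, mul_comm]

theorem frobeniusInner_add_right (A B C : Matrix m l ℝ) :
    frobeniusInner A (B + C) = frobeniusInner A B + frobeniusInner A C := by
  simp [frobeniusInner, Matrix.mul_add]

theorem frobeniusInner_sub_right (A B C : Matrix m l ℝ) :
    frobeniusInner A (B - C) = frobeniusInner A B - frobeniusInner A C := by
  simp [frobeniusInner, Matrix.mul_sub]

theorem frobeniusInner_neg_right (A B : Matrix m l ℝ) :
    frobeniusInner A (-B) = -frobeniusInner A B := by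
  simp [frobeniusInner]

theorem frobeniusInner_smul_right (A B : Matrix m l ℝ) (t : ℝ) :
    frobeniusInner A (t • B) = t * frobeniusInner A B := by
  simp [frobeniusInner]

theorem frobeniusInner_add_left (A B C : Matrix m l ℝ) :
    frobeniusInner (A + B) C = frobeniusInner A C + frobeniusInner B C := by
  simp [frobeniusInner, Matrix.add_mul]

theorem frobeniusInner_sub_left (A B C : Matrix m l ℝ) :
    frobeniusInner (A - B) C = frobeniusInner A C - frobeniusInner B C := by
  simp [frobeniusInner, Matrix.sub_mul]

theorem frobeniusInner_smul_left (A B : Matrix m l ℝ) (t : ℝ) :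
    frobeniusInner (t • A) B = t * frobeniusInner A B := by
  simp [frobeniusInner]

theorem frobeniusInner_mul_right (A : Matrix m l ℝ) (L : Matrix m r ℝ) (B : Matrix r l ℝ) :
    frobeniusInner A (L * B) = frobeniusInner (Lᵀ * A) B := by
  simp [frobeniusInner, Matrix.mul_assoc]

theorem frobenius_norm_add_sq (A B : Matrix m l ℝ) :
    ‖A + B‖ ^ 2 = ‖A‖ ^ 2 + 2 * frobeniusInner A B + ‖B‖ ^ 2 := by
  simp only [← frobeniusInner_self, frobeniusInner_add_left, frobeniusInner_add_right]
  rw [frobeniusInner_comm B A]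
  ring

theorem frobenius_norm_sub_sq (A B : Matrix m l ℝ) :
    ‖A - B‖ ^ 2 = ‖A‖ ^ 2 - 2 * frobeniusInner A B + ‖B‖ ^ 2 := by
  simp only [← frobeniusInner_self, frobeniusInner_sub_left, frobeniusInner_sub_right]
  rw [frobeniusInner_comm B A]
  ring

theorem frobeniusInner_le (A B : Matrix m l ℝ) : frobeniusInner A B ≤ ‖A‖ * ‖B‖ := by
  have h := frobenius_norm_add_sq A B
  have h1 : ‖A + B‖ ^ 2 ≤ (‖A‖ + ‖B‖) ^ 2 := by gcongr; exact norm_add_le A B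
  nlinarith

theorem neg_le_frobeniusInner (A B : Matrix m l ℝ) : -(‖A‖ * ‖B‖) ≤ frobeniusInner A B := by
  have h := frobeniusInner_le A (-B)
  rw [frobeniusInner_neg_right, norm_neg] at h
  linarith

theorem eq_zero_of_frobeniusInner_eq_zero (A : Matrix m l ℝ)
    (h : ∀ B, frobeniusInner A B = 0) : A = 0 := by
  have := h A
  rw [frobeniusInner_self] at this
  simpa using this

theorem frobenius_norm_sq_of_orthonormal [DecidableEq l] {P : Matrix m l ℝ} (hP : Pᵀ * P = 1) :
    ‖P‖ ^ 2 = Fintype.card l := by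
  rw [← frobeniusInner_self, frobeniusInner, hP, Matrix.trace_one]

theorem frobenius_norm_mul_of_orthonormal [DecidableEq r] {P : Matrix m r ℝ} (hP : Pᵀ * P = 1)
    (A : Matrix r l ℝ) : ‖P * A‖ = ‖A‖ := by
  have : ‖P * A‖ ^ 2 = ‖A‖ ^ 2 := by
    rw [← frobeniusInner_self, frobeniusInner_mul_right, ← Matrix.mul_assoc, hP, Matrix.one_mul,
      frobeniusInner_self]
  exact (sq_eq_sq₀ (norm_nonneg _) (norm_nonneg _)).1 this

/-- The gap in squared distance from `P * T`, `T` symmetric, between two orthonormal frames. -/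
theorem frobenius_norm_sub_sq_sub [DecidableEq l] {P Q : Matrix m l ℝ} {T : Matrix l l ℝ}
    (hP : Pᵀ * P = 1) (hQ : Qᵀ * Q = 1) (hT : Tᵀ = T) :
    ‖P * T - Q‖ ^ 2 - ‖P * T - P‖ ^ 2 = frobeniusInner T ((P - Q)ᵀ * (P - Q)) := by
  have h1 : frobeniusInner T (Qᵀ * P) = frobeniusInner T (Pᵀ * Q) := by
    unfold frobeniusInner
    rw [← Matrix.trace_transpose (Tᵀ * (Qᵀ * P)), Matrix.transpose_mul, Matrix.transpose_mul,
      Matrix.transpose_transpose, Matrix.transpose_transpose, Matrix.trace_mul_comm, hT]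
  have h2 : ∀ Z : Matrix m l ℝ, frobeniusInner (P * T) Z = frobeniusInner T (Pᵀ * Z) := by
    intro Z
    rw [frobeniusInner_comm, frobeniusInner_mul_right, frobeniusInner_comm]
  rw [frobenius_norm_sub_sq, frobenius_norm_sub_sq, frobenius_norm_sq_of_orthonormal hP,
    frobenius_norm_sq_of_orthonormal hQ, h2, h2, hP]
  simp only [Matrix.transpose_sub, Matrix.mul_sub, Matrix.sub_mul, hP, hQ,
    frobeniusInner_sub_right, h1]
  ring

/-- A product of `B = P S` against a change of frame, for symmetric `S`. -/
theorem frobeniusInner_mul_sub [DecidableEq l] {P Q : Matrix m l ℝ} {S : Matrix l l ℝ}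
    (hP : Pᵀ * P = 1) (hQ : Qᵀ * Q = 1) (hS : Sᵀ = S) :
    2 * frobeniusInner (P * S) (P - Q) = frobeniusInner S ((P - Q)ᵀ * (P - Q)) := by
  have h := frobenius_norm_sub_sq_sub hP hQ hS
  rw [frobenius_norm_sub_sq, frobenius_norm_sub_sq, frobenius_norm_sq_of_orthonormal hP,
    frobenius_norm_sq_of_orthonormal hQ] at h
  rw [frobeniusInner_sub_right]
  linarith

/-- A kernel vector satisfies `v = -Sv`, which `‖S‖ < 1` forbids unless `v = 0`. Viewing `v` as a
one-column matrix lets Frobenius submultiplicativity apply. -/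
theorem isUnit_one_add_of_norm_lt_one [DecidableEq l] {S : Matrix l l ℝ} (hS : ‖S‖ < 1) :
    IsUnit (1 + S) := by
  rw [← Matrix.mulVec_injective_iff_isUnit]
  have key : ∀ v : l → ℝ, (1 + S) *ᵥ v = 0 → v = 0 := by
    intro v hv
    set A : Matrix l Unit ℝ := Matrix.of fun i _ => v i with hA
    have h1 : A = -(S * A) := by
      ext i j
      have := congrFun hv i
      rw [Matrix.add_mulVec, Matrix.one_mulVec] at this
      simp only [Pi.add_apply, Pi.zero_apply, Matrix.mulVec, dotProduct] at this
      simp only [hA, Matrix.of_apply, Matrix.neg_apply, Matrix.mul_apply]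
      linarith
    have h2 : ‖A‖ ≤ ‖S‖ * ‖A‖ := by
      calc ‖A‖ = ‖S * A‖ := by rw [← norm_neg (S * A), ← h1]
        _ ≤ _ := Matrix.frobenius_norm_mul S A
    have h3 : ‖A‖ = 0 := by nlinarith [norm_nonneg A]
    have h4 : A = 0 := by simpa using h3
    ext i
    simpa [hA] using congrFun (congrFun h4 i) ()
  intro v w hvw
  have := key (v - w) (by rw [Matrix.mulVec_sub]; exact sub_eq_zero.2 hvw)
  exact sub_eq_zero.1 this

/-- The symmetric factor of a matrix near an orthonormal frame is a Lipschitz function of its Gram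
matrix. -/
theorem norm_sub_le_of_sq [DecidableEq l] {S S' : Matrix l l ℝ} (hS : ‖S‖ ≤ 1 / 2)
    (hS' : ‖S'‖ ≤ 1 / 2) :
    ‖S' - S‖ ≤ ‖(1 + S') * (1 + S') - (1 + S) * (1 + S)‖ := by
  set N := (1 + S') * (1 + S') - (1 + S) * (1 + S)
  -- The remainder is at most `(‖S‖ + ‖S'‖)‖S' - S‖ ≤ ‖S' - S‖`, so one of the two copies of `S' -
  -- S` survives.
  have h : (2 : ℝ) • (S' - S) = N - (S' * (S' - S) + (S' - S) * S) := by
    simp only [N]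
    rw [two_smul]
    noncomm_ring
  have h1 : 2 * ‖S' - S‖ ≤ ‖N‖ + (‖S'‖ * ‖S' - S‖ + ‖S' - S‖ * ‖S‖) := by
    calc 2 * ‖S' - S‖ = ‖(2 : ℝ) • (S' - S)‖ := by rw [norm_smul]; norm_num
      _ ≤ ‖N‖ + ‖S' * (S' - S) + (S' - S) * S‖ := by rw [h]; exact norm_sub_le _ _
      _ ≤ _ := by
        gcongr
        refine (norm_add_le _ _).trans ?_
        gcongr
        · exact Matrix.frobenius_norm_mul _ _
        · exact Matrix.frobenius_norm_mul _ _
  nlinarith [norm_nonneg (S' - S)]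

/-- Perturbation of the Gram matrix of `P + R`. -/
theorem norm_gram_sub_le [DecidableEq l] {P Q R R' : Matrix m l ℝ} {a : ℝ} (hP : Pᵀ * P = 1)
    (hQ : Qᵀ * Q = 1) (hQa : ‖Q‖ + 1 / 2 ≤ a)
    (hR : ‖R‖ ≤ 1 / 2) (hR' : ‖R'‖ ≤ 1 / 2) :
    ‖(Q + R')ᵀ * (Q + R') - (P + R)ᵀ * (P + R)‖ ≤ 2 * a * ‖R' - R‖ + 2 * ‖R‖ * ‖Q - P‖ := by
  set Z := Qᵀ * (R' - R) + (Q - P)ᵀ * R with hZ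
  set W := R'ᵀ * (R' - R) + (R' - R)ᵀ * R with hW
  -- Since `PᵀP = QᵀQ`, the frames' own Gram matrices cancel and `Q - P` appears only multiplied by
  -- `R`.
  have h : (Q + R')ᵀ * (Q + R') - (P + R)ᵀ * (P + R) = Z + Zᵀ + W := by
    simp only [hZ, hW, Matrix.transpose_add, Matrix.transpose_mul, Matrix.transpose_sub,
      Matrix.transpose_transpose, Matrix.mul_add, Matrix.add_mul, Matrix.mul_sub, Matrix.sub_mul,
      hP, hQ]
    abel
  have hZn : ‖Z‖ ≤ ‖Q‖ * ‖R' - R‖ + ‖Q - P‖ * ‖R‖ := by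
    refine (norm_add_le _ _).trans ?_
    gcongr
    · exact (Matrix.frobenius_norm_mul _ _).trans_eq (by rw [Matrix.frobenius_norm_transpose])
    · exact (Matrix.frobenius_norm_mul _ _).trans_eq (by rw [Matrix.frobenius_norm_transpose])
  have hWn : ‖W‖ ≤ ‖R'‖ * ‖R' - R‖ + ‖R' - R‖ * ‖R‖ := by
    refine (norm_add_le _ _).trans ?_
    gcongr
    · exact (Matrix.frobenius_norm_mul _ _).trans_eq (by rw [Matrix.frobenius_norm_transpose])
    · exact (Matrix.frobenius_norm_mul _ _).trans_eq (by rw [Matrix.frobenius_norm_transpose])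
  have h3 : ‖Z + Zᵀ + W‖ ≤ ‖Z‖ + ‖Z‖ + ‖W‖ := by
    refine (norm_add_le _ _).trans ?_
    gcongr
    exact (norm_add_le _ _).trans_eq (by rw [Matrix.frobenius_norm_transpose])
  rw [h]
  nlinarith [norm_nonneg (R' - R)]

theorem posSemidef_frobeniusInner_nonneg {T : Matrix l l ℝ} (hT : T.PosSemidef)
    (A : Matrix m l ℝ) : 0 ≤ frobeniusInner T (Aᵀ * A) := by
  have h := (hT.mul_mul_conjTranspose_same A).trace_nonneg
  rw [Matrix.conjTranspose_eq_transpose_of_trivial, Matrix.mul_assoc, Matrix.trace_mul_comm] at h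
  have hs : Tᵀ = T := by
    rw [← Matrix.conjTranspose_eq_transpose_of_trivial]; exact hT.isHermitian
  rw [frobeniusInner, hs]
  simpa [Matrix.mul_assoc] using h

end FrobeniusInner

end DFSOS

/-! ### Indicator Gram matrix, polar factors, scores subproblem and stationarity -/

namespace DFSOS

variable {n K p q : ℕ}

theorem indicatorMatrix_eq_smul (c : Fin n → Fin K) :
    indicatorMatrix c = Real.sqrt n • scaledIndicator c := by
  rcases Nat.eq_zero_or_pos n with rfl | hn
  · ext i
    exact i.elim0
  · have : Real.sqrt n ≠ 0 := by positivity
    rw [scaledIndicator, smul_smul, mul_one_div_cancel this, one_smul]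

theorem scaledIndicator_gram (c : Fin n → Fin K) :
    (scaledIndicator c)ᵀ * scaledIndicator c
      = (1 / (n : ℝ)) • ((indicatorMatrix c)ᵀ * indicatorMatrix c) := by
  have : (Real.sqrt n)⁻¹ * (Real.sqrt n)⁻¹ = (n : ℝ)⁻¹ := by
    rw [← mul_inv, Real.mul_self_sqrt (Nat.cast_nonneg n)]
  simp [scaledIndicator, smul_smul, this]

/-- `YᵀY` is diagonal with the class sizes as entries, which are nonzero because no class is empty.
-/
theorem exists_mul_gram_eq_one {c : Fin n → Fin K} (hc : Function.Surjective c) :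
    ∃ G : Matrix (Fin K) (Fin K) ℝ, G * ((scaledIndicator c)ᵀ * scaledIndicator c) = 1 := by
  set m : Fin K → ℝ := fun j => ∑ i, if c i = j then 1 else 0 with hm
  have hY : (indicatorMatrix c)ᵀ * indicatorMatrix c = Matrix.diagonal m := by
    ext j j'
    rw [Matrix.diagonal_apply]
    simp only [Matrix.mul_apply, indicatorMatrix, Matrix.transpose_apply, Matrix.of_apply, hm]
    split_ifs with h
    · subst h
      exact Finset.sum_congr rfl fun i _ => by simp
    · refine Finset.sum_eq_zero fun i _ => ?_
      by_cases h1 : c i = j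
      · simp [h1, h]
      · simp [h1]
  have hmpos : ∀ j, m j ≠ 0 := by
    intro j
    obtain ⟨i, hi⟩ := hc j
    refine ne_of_gt (Finset.sum_pos' (fun i _ => by positivity) ⟨i, Finset.mem_univ i, ?_⟩)
    simp [hi]
  refine ⟨Matrix.diagonal fun j => n * (m j)⁻¹, ?_⟩
  rw [scaledIndicator_gram, hY, Matrix.mul_smul, Matrix.diagonal_mul_diagonal,
    ← Matrix.diagonal_smul, ← Matrix.diagonal_one]
  congr 1
  ext j
  have hn : (n : ℝ) ≠ 0 := by
    obtain ⟨i, -⟩ := hc j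
    have := i.pos
    positivity
  have := hmpos j
  simp
  field_simp

theorem rectIdentity_gram (h : q ≤ n) : (rectIdentity n q)ᵀ * rectIdentity n q = 1 := by
  ext j j'
  rw [Matrix.one_apply, Matrix.mul_apply,
    Finset.sum_eq_single (⟨j, j.2.trans_le h⟩ : Fin n)]
  · simp [rectIdentity, Fin.ext_iff]
  · intro i _ hi
    have : (i : ℕ) ≠ j := fun h => hi (Fin.ext h)
    simp [rectIdentity, this]
  · simp

/-- The polar factorization `M = P (1 + S)` read off from a singular value decomposition. -/
theorem IsSVD.exists_polar {M D : Matrix (Fin n) (Fin q) ℝ} {U : Matrix (Fin n) (Fin n) ℝ}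
    {V : Matrix (Fin q) (Fin q) ℝ} (hM : IsSVD M U D V) (h : q ≤ n)
    {P : Matrix (Fin n) (Fin q) ℝ} (hP : P = U * rectIdentity n q * Vᵀ) :
    Pᵀ * P = 1 ∧ ∃ S : Matrix (Fin q) (Fin q) ℝ,
      Sᵀ = S ∧ (1 + S).PosSemidef ∧ M = P * (1 + S) := by
  obtain ⟨hU, hV, hD, hD0, hMeq⟩ := hM
  have hU1 : Uᵀ * U = 1 := by
    have := (Matrix.mem_orthogonalGroup_iff' (Fin n) ℝ).1 hU
    simpa [Matrix.star_eq_conjTranspose] using this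
  have hV1 : Vᵀ * V = 1 := by
    have := (Matrix.mem_orthogonalGroup_iff' (Fin q) ℝ).1 hV
    simpa [Matrix.star_eq_conjTranspose] using this
  have hV2 : V * Vᵀ = 1 := by
    have := (Matrix.mem_orthogonalGroup_iff (Fin q) ℝ).1 hV
    simpa [Matrix.star_eq_conjTranspose] using this
  set d : Fin q → ℝ := fun j => D ⟨j, j.2.trans_le h⟩ j
  have hDd : D = rectIdentity n q * Matrix.diagonal d := by
    ext i j
    rw [Matrix.mul_diagonal]
    by_cases hij : (i : ℕ) = j
    · have : i = ⟨j, j.2.trans_le h⟩ := Fin.ext hij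
      subst this
      simp [rectIdentity, d]
    · simp [rectIdentity, hij, hD i j hij]
  have hT : (V * Matrix.diagonal d * Vᵀ).PosSemidef := by
    have hd : (Matrix.diagonal d).PosSemidef :=
      Matrix.PosSemidef.diagonal fun j => hD0 _ _
    simpa using hd.mul_mul_conjTranspose_same V
  refine ⟨?_, V * Matrix.diagonal d * Vᵀ - 1, ?_, ?_, ?_⟩
  · calc Pᵀ * P = V * ((rectIdentity n q)ᵀ * (Uᵀ * U) * rectIdentity n q) * Vᵀ := by
          simp only [hP, Matrix.transpose_mul, Matrix.transpose_transpose, Matrix.mul_assoc]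
      _ = 1 := by rw [hU1, Matrix.mul_one, rectIdentity_gram h, Matrix.mul_one, hV2]
  · simp [Matrix.transpose_mul, Matrix.mul_assoc]
  · rwa [add_sub_cancel]
  · rw [add_sub_cancel, hMeq, hP, hDd]
    calc U * (rectIdentity n q * Matrix.diagonal d) * Vᵀ
        = U * rectIdentity n q * (1 : Matrix (Fin q) (Fin q) ℝ) * Matrix.diagonal d * Vᵀ := by
          simp only [Matrix.mul_assoc, Matrix.one_mul]
      _ = _ := by rw [← hV1]; simp only [Matrix.mul_assoc]

theorem le_of_orthonormal {P : Matrix (Fin n) (Fin q) ℝ} (hP : Pᵀ * P = 1) : q ≤ n := by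
  have h1 : (Pᵀ * P).rank ≤ P.rank := Matrix.rank_mul_le_right _ _
  rw [hP, Matrix.rank_one, Fintype.card_fin] at h1
  exact h1.trans ((Matrix.rank_le_card_height P).trans_eq (Fintype.card_fin n))

/-! ### The subproblem in the scores and discriminant vectors -/

/-- The `ℓ₁` term is convex, and the quadratic part contributes its exact convexity defect. Keeping
that defect is what later supplies the decrease. -/
theorem objective_add_smul_le (c : Fin n → Fin K) (X : Matrix (Fin n) (Fin p) ℝ) {γ lam : ℝ}
    (hlam : 0 ≤ lam) (θ dθ : Matrix (Fin K) (Fin q) ℝ) (β dβ : Matrix (Fin p) (Fin q) ℝ)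
    {t : ℝ} (ht : 0 ≤ t) (ht1 : t ≤ 1) :
    objective c X γ lam (θ + t • dθ) (β + t • dβ) ≤ objective c X γ lam θ β
      + t * (objective c X γ lam (θ + dθ) (β + dβ) - objective c X γ lam θ β)
      - t * (1 - t) * (‖indicatorMatrix c * dθ - X * dβ‖ ^ 2 + γ * ‖dβ‖ ^ 2) := by
  have hE : ∀ s : ℝ, indicatorMatrix c * (θ + s • dθ) - X * (β + s • dβ)
      = (indicatorMatrix c * θ - X * β) + s • (indicatorMatrix c * dθ - X * dβ) := by
    intro s
    simp only [Matrix.mul_add, Matrix.mul_smul, smul_sub]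
    abel
  have hl : ∑ i, ∑ j, |(β + t • dβ) i j| ≤ (1 - t) * ∑ i, ∑ j, |β i j|
      + t * ∑ i, ∑ j, |(β + dβ) i j| := by
    simp only [Finset.mul_sum, ← Finset.sum_add_distrib]
    refine Finset.sum_le_sum fun i _ => Finset.sum_le_sum fun j _ => ?_
    have : (β + t • dβ) i j = (1 - t) * β i j + t * (β + dβ) i j := by
      simp; ring
    rw [this]
    refine (abs_add_le _ _).trans_eq ?_
    rw [abs_mul, abs_mul, abs_of_nonneg ht, abs_of_nonneg (by linarith : 0 ≤ 1 - t)]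
  have hl' := mul_le_mul_of_nonneg_left hl hlam
  have h1 := hE 1
  have ht' := hE t
  rw [one_smul, one_smul, one_smul] at h1
  simp only [objective]
  rw [h1, ht']
  simp only [frobenius_norm_add_sq, frobeniusInner_smul_right, norm_smul, mul_pow, Real.norm_eq_abs,
    sq_abs]
  linarith

theorem nonneg_of_forall_add_mul_nonneg {a b : ℝ}
    (h : ∀ t : ℝ, 0 < t → t ≤ 1 → 0 ≤ a + t * b) : 0 ≤ a := by
  have h1 : Tendsto (fun t : ℝ => a + t * b) (𝓝[>] 0) (𝓝 (a + 0 * b)) :=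
    ((continuous_const.add (continuous_id.mul continuous_const)).tendsto 0).mono_left
      nhdsWithin_le_nhds
  rw [zero_mul, add_zero] at h1
  refine ge_of_tendsto h1 ?_
  filter_upwards [Ioc_mem_nhdsGT (zero_lt_one' ℝ)] with t ht using h t ht.1 ht.2

/-- The growth of the objective away from a minimizer of the penalized subproblem. -/
theorem objective_ge_of_isMinOn (c : Fin n → Fin K) (X : Matrix (Fin n) (Fin p) ℝ)
    {γ lam ρ : ℝ} (hlam : 0 ≤ lam) {θ : Matrix (Fin K) (Fin q) ℝ} {β : Matrix (Fin p) (Fin q) ℝ}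
    {A : Matrix (Fin n) (Fin q) ℝ}
    (hmin : ∀ θ' β', objective c X γ lam θ β + ρ / 2 * ‖scaledIndicator c * θ + A‖ ^ 2
      ≤ objective c X γ lam θ' β' + ρ / 2 * ‖scaledIndicator c * θ' + A‖ ^ 2)
    (dθ : Matrix (Fin K) (Fin q) ℝ) (dβ : Matrix (Fin p) (Fin q) ℝ) :
    objective c X γ lam θ β + (‖indicatorMatrix c * dθ - X * dβ‖ ^ 2 + γ * ‖dβ‖ ^ 2)
      - ρ * frobeniusInner (scaledIndicator c * θ + A) (scaledIndicator c * dθ)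
      ≤ objective c X γ lam (θ + dθ) (β + dβ) := by
  set Q := ‖indicatorMatrix c * dθ - X * dβ‖ ^ 2 + γ * ‖dβ‖ ^ 2 with hQ
  set R := scaledIndicator c * θ + A with hR
  -- Minimality is compared along the segment `(θ + t dθ, β + t dβ)`, divided by `t`, and `t` is
  -- sent to `0`.
  have key := nonneg_of_forall_add_mul_nonneg
    (a := objective c X γ lam (θ + dθ) (β + dβ) - objective c X γ lam θ β - Q
      + ρ * frobeniusInner R (scaledIndicator c * dθ))
    (b := Q + ρ / 2 * ‖scaledIndicator c * dθ‖ ^ 2) (by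
      intro t ht ht1
      have h1 := hmin (θ + t • dθ) (β + t • dβ)
      have h2 := objective_add_smul_le c X (γ := γ) hlam θ dθ β dβ ht.le ht1
      have h3 : scaledIndicator c * (θ + t • dθ) + A = R + t • (scaledIndicator c * dθ) := by
        simp only [hR, Matrix.mul_add, Matrix.mul_smul]
        abel
      rw [h3, frobenius_norm_add_sq R, frobeniusInner_smul_right, norm_smul, mul_pow,
        Real.norm_eq_abs, sq_abs] at h1
      rw [← hQ] at h2
      have h4 : 0 ≤ t * (objective c X γ lam (θ + dθ) (β + dβ) - objective c X γ lam θ β - Q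
          + ρ * frobeniusInner R (scaledIndicator c * dθ)
          + t * (Q + ρ / 2 * ‖scaledIndicator c * dθ‖ ^ 2)) := by
        linarith
      exact nonneg_of_mul_nonneg_right h4 ht)
  linarith

/-- The optimality condition of the penalized subproblem in the scores. -/
theorem gradient_eq_zero_of_isMinOn (c : Fin n → Fin K) (X : Matrix (Fin n) (Fin p) ℝ)
    {γ lam ρ : ℝ} (hlam : 0 ≤ lam) {θ : Matrix (Fin K) (Fin q) ℝ} {β : Matrix (Fin p) (Fin q) ℝ}
    {A : Matrix (Fin n) (Fin q) ℝ}
    (hmin : ∀ θ' β', objective c X γ lam θ β + ρ / 2 * ‖scaledIndicator c * θ + A‖ ^ 2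
      ≤ objective c X γ lam θ' β' + ρ / 2 * ‖scaledIndicator c * θ' + A‖ ^ 2) :
    ρ • ((scaledIndicator c)ᵀ * (scaledIndicator c * θ + A))
      = -((2 : ℝ) • ((indicatorMatrix c)ᵀ * (indicatorMatrix c * θ - X * β))) := by
  have h : ∀ d, 0 ≤ frobeniusInner (ρ • ((scaledIndicator c)ᵀ * (scaledIndicator c * θ + A))
      + (2 : ℝ) • ((indicatorMatrix c)ᵀ * (indicatorMatrix c * θ - X * β))) d := by
    intro d
    -- With `dβ = 0` the nonsmooth term drops out and `‖Yd‖²` cancels, leaving a linear functional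
    -- that is nonnegative for every `d`, hence zero.
    have h1 := objective_ge_of_isMinOn c X hlam hmin d 0
    have h2 : indicatorMatrix c * (θ + d) - X * (β + 0)
        = (indicatorMatrix c * θ - X * β) + indicatorMatrix c * d := by
      rw [Matrix.mul_add, add_zero]
      abel
    simp only [objective] at h1
    rw [h2, frobenius_norm_add_sq, add_zero, Matrix.mul_zero, sub_zero, norm_zero,
      frobeniusInner_mul_right, frobeniusInner_mul_right] at h1
    rw [frobeniusInner_add_left, frobeniusInner_smul_left, frobeniusInner_smul_left]
    linarith
  refine eq_neg_of_add_eq_zero_left (eq_zero_of_frobeniusInner_eq_zero _ fun d => ?_)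
  have h2 := h (-d)
  rw [frobeniusInner_neg_right] at h2
  exact le_antisymm (by linarith) (h d)

/-! ### Stationarity -/

theorem augmentedLagrangian_of_orthonormal (c : Fin n → Fin K) (X : Matrix (Fin n) (Fin p) ℝ)
    (γ lam ρ : ℝ) (B : Matrix (Fin n) (Fin q) ℝ) (θ : Matrix (Fin K) (Fin q) ℝ)
    (β : Matrix (Fin p) (Fin q) ℝ) {P : Matrix (Fin n) (Fin q) ℝ} (hP : Pᵀ * P = 1) :
    augmentedLagrangian c X γ lam ρ B (θ, β, P)
      = ((objective c X γ lam θ β + ρ * frobeniusInner B (scaledIndicator c * θ - P)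
        + ρ / 2 * ‖scaledIndicator c * θ - P‖ ^ 2 : ℝ) : EReal) :=
  if_pos hP

theorem regularSubdifferential_subset_limiting {E : Type*} [NormedAddCommGroup E]
    [NormedSpace ℝ E] (f : E → EReal) (x : E) :
    regularSubdifferential f x ⊆ limitingSubdifferential f x := fun v hv =>
  ⟨hv.1, hv.2.1, fun _ => x, fun _ => v, tendsto_const_nhds, tendsto_const_nhds, fun _ => hv,
    tendsto_const_nhds⟩

/-- Here zero is even a regular subgradient. Convexity handles `(θ, β)` globally. The term left
over, `ρ⟨B, P - P'⟩`, is quadratic in `P - P'` on the constraint set because `B = PS` with `S`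
symmetric, hence `o(‖z - z₀‖)`. -/
theorem zero_mem_limitingSubdifferential (c : Fin n → Fin K) (X : Matrix (Fin n) (Fin p) ℝ)
    {γ lam ρ : ℝ} (hγ : 0 ≤ γ) (hlam : 0 ≤ lam) (hρ : 0 < ρ)
    {θ : Matrix (Fin K) (Fin q) ℝ} {β : Matrix (Fin p) (Fin q) ℝ}
    {P B : Matrix (Fin n) (Fin q) ℝ} {S : Matrix (Fin q) (Fin q) ℝ} (hP : Pᵀ * P = 1)
    (hPθ : P = scaledIndicator c * θ) (hS : Sᵀ = S) (hB : B = P * S)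
    (hmin : ∀ θ' β', objective c X γ lam θ β + ρ / 2 * ‖scaledIndicator c * θ + (B - P)‖ ^ 2
      ≤ objective c X γ lam θ' β' + ρ / 2 * ‖scaledIndicator c * θ' + (B - P)‖ ^ 2) :
    0 ∈ limitingSubdifferential (augmentedLagrangian c X γ lam ρ B) (θ, β, P) := by
  refine regularSubdifferential_subset_limiting _ _ ⟨?_, ?_, ?_⟩
  · rw [augmentedLagrangian_of_orthonormal _ _ _ _ _ _ _ _ hP]
    exact EReal.coe_ne_top _
  · rw [augmentedLagrangian_of_orthonormal _ _ _ _ _ _ _ _ hP]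
    exact EReal.coe_ne_bot _
  intro ε hε
  -- This radius makes `(ρ/2)‖S‖N² ≤ εN` for `N` below it; the `+ 1` avoids division by zero.
  have hδ : 0 < 2 * ε / (ρ * (‖S‖ + 1)) := by positivity
  filter_upwards [Metric.ball_mem_nhds (θ, β, P) hδ] with z hz
  obtain ⟨θ', β', P'⟩ := z
  by_cases hP' : P'ᵀ * P' = 1
  swap
  · rw [show augmentedLagrangian c X γ lam ρ B (θ', β', P') = ⊤ from if_neg hP']
    exact le_top
  rw [augmentedLagrangian_of_orthonormal _ _ _ _ _ _ _ _ hP,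
    augmentedLagrangian_of_orthonormal _ _ _ _ _ _ _ _ hP', ← EReal.coe_add, EReal.coe_le_coe_iff,
    ← hPθ, sub_self]
  have hnP : ‖P - P'‖ ≤ ‖(θ', β', P') - (θ, β, P)‖ := by
    rw [norm_sub_rev]
    exact (le_max_right _ _).trans (le_max_right _ _)
  set N := ‖(θ', β', P') - (θ, β, P)‖ with hN
  have hNδ : N * (ρ * (‖S‖ + 1)) ≤ 2 * ε := by
    rw [Metric.mem_ball, dist_eq_norm, ← hN, lt_div_iff₀ (by positivity)] at hz
    exact hz.le
  have h1 := objective_ge_of_isMinOn c X hlam hmin (θ' - θ) (β' - β)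
  have h2 : scaledIndicator c * θ + (B - P) = B := by rw [← hPθ]; abel
  have h3 : scaledIndicator c * (θ' - θ) = (scaledIndicator c * θ' - P') - (P - P') := by
    rw [Matrix.mul_sub, ← hPθ]; abel
  rw [add_sub_cancel, add_sub_cancel, h2, h3, frobeniusInner_sub_right] at h1
  have h4 := frobeniusInner_mul_sub hP hP' hS
  rw [← hB] at h4
  have h5 := neg_le_frobeniusInner S ((P - P')ᵀ * (P - P'))
  have h6 : ‖(P - P')ᵀ * (P - P')‖ ≤ N * N := by
    refine (Matrix.frobenius_norm_mul _ _).trans ?_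
    rw [Matrix.frobenius_norm_transpose]
    gcongr
  have h7 : ‖S‖ * ‖(P - P')ᵀ * (P - P')‖ ≤ ‖S‖ * (N * N) := by gcongr
  have hN0 : 0 ≤ N := norm_nonneg _
  have h8 : ρ * (‖S‖ * (N * N)) ≤ 2 * (ε * N) := by
    nlinarith [mul_nonneg hρ.le (mul_nonneg hN0 hN0), mul_le_mul_of_nonneg_left hNδ hN0]
  have h9 : -(ε * N) ≤ ρ * frobeniusInner B (P - P') := by
    nlinarith [mul_le_mul_of_nonneg_left (h5.trans_eq h4.symm) hρ.le,
      mul_le_mul_of_nonneg_left h7 hρ.le]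
  have h10 : 0 ≤ ‖indicatorMatrix c * (θ' - θ) - X * (β' - β)‖ ^ 2 + γ * ‖β' - β‖ ^ 2 := by
    positivity
  have h11 : 0 ≤ ρ / 2 * ‖scaledIndicator c * θ' - P'‖ ^ 2 := by positivity
  have h12 : frobeniusInner B (0 : Matrix (Fin n) (Fin q) ℝ) = 0 := by
    simp [frobeniusInner]
  rw [h12, norm_zero]
  rw [zero_apply]
  linarith

end DFSOS

/-! ### One update of the frame and the multiplier -/

namespace DFSOS

variable {n K p q : ℕ}

theorem objective_nonneg (c : Fin n → Fin K) (X : Matrix (Fin n) (Fin p) ℝ) {γ lam : ℝ}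
    (hγ : 0 ≤ γ) (hlam : 0 ≤ lam) (θ : Matrix (Fin K) (Fin q) ℝ) (β : Matrix (Fin p) (Fin q) ℝ) :
    0 ≤ objective c X γ lam θ β := by
  unfold objective
  positivity

theorem sq_norm_add_le_objective (c : Fin n → Fin K) (X : Matrix (Fin n) (Fin p) ℝ) {γ lam : ℝ}
    (hlam : 0 ≤ lam) (θ : Matrix (Fin K) (Fin q) ℝ) (β : Matrix (Fin p) (Fin q) ℝ) :
    ‖indicatorMatrix c * θ - X * β‖ ^ 2 + γ * ‖β‖ ^ 2 ≤ objective c X γ lam θ β := by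
  have : 0 ≤ lam * ∑ i, ∑ j, |β i j| := by positivity
  unfold objective
  linarith

theorem continuous_objective (c : Fin n → Fin K) (X : Matrix (Fin n) (Fin p) ℝ) (γ lam : ℝ) :
    Continuous (fun z : Matrix (Fin K) (Fin q) ℝ × Matrix (Fin p) (Fin q) ℝ =>
      objective c X γ lam z.1 z.2) := by
  unfold objective
  fun_prop

/-- What is known of the pair `(P, B)` at each iterate. -/
structure IsAdmissible (c : Fin n → Fin K) (P B : Matrix (Fin n) (Fin q) ℝ) : Prop where
  range_P : ∃ x : Matrix (Fin K) (Fin q) ℝ, P = scaledIndicator c * x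
  range_B : ∃ x : Matrix (Fin K) (Fin q) ℝ, B = scaledIndicator c * x
  orthonormal : Pᵀ * P = 1
  norm_B : ‖B‖ ≤ 1 / 2

/-- What is known of an update `(P, B) ↦ (P', B')` through `P + R = P' + B'`, where `(θ, β)` is
the new value of the scores and the discriminant vectors. -/
structure IsUpdate (c : Fin n → Fin K) (X : Matrix (Fin n) (Fin p) ℝ) (γ lam a : ℝ)
    (θ : Matrix (Fin K) (Fin q) ℝ) (β : Matrix (Fin p) (Fin q) ℝ)
    (P R P' B' : Matrix (Fin n) (Fin q) ℝ) : Prop where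
  objective_le : objective c X γ lam θ β ≤ n * a ^ 2
  norm_R : ‖R‖ ≤ 1 / 2
  norm_B_le : ‖B'‖ ≤ ‖R‖
  polar : ∃ S : Matrix (Fin q) (Fin q) ℝ, Sᵀ = S ∧ B' = P' * S ∧ P + R = P' * (1 + S)
  descent : ‖B'‖ ^ 2 + 1 / 2 * ‖P' - P‖ ^ 2 ≤ ‖R‖ ^ 2

theorem norm_indicatorMatrix_mul_sq (c : Fin n → Fin K) (θ : Matrix (Fin K) (Fin q) ℝ) :
    ‖indicatorMatrix c * θ‖ ^ 2 = n * ‖scaledIndicator c * θ‖ ^ 2 := by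
  rw [indicatorMatrix_eq_smul, Matrix.smul_mul, norm_smul, mul_pow, Real.norm_eq_abs, sq_abs,
    Real.sq_sqrt (Nat.cast_nonneg n)]

theorem norm_of_orthonormal {P : Matrix (Fin n) (Fin q) ℝ} (hP : Pᵀ * P = 1) :
    ‖P‖ = Real.sqrt q := by
  have := frobenius_norm_sq_of_orthonormal hP
  rw [Fintype.card_fin] at this
  rw [← this, Real.sqrt_sq (norm_nonneg _)]

/-- This is the induction step that keeps the iterates in the regime of small residuals. Membership
in the range of `L` makes the test point available, and the resulting smallness of `S` returns the
new pair to that range. -/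
theorem IsAdmissible.update (c : Fin n → Fin K) (X : Matrix (Fin n) (Fin p) ℝ)
    {γ lam ρ a : ℝ} (hγ : 0 ≤ γ) (hlam : 0 ≤ lam) (hρ : 0 < ρ) (ha : a = Real.sqrt q + 1 / 2)
    (hρa : 8 * n * a ^ 2 ≤ ρ) {θ : Matrix (Fin K) (Fin q) ℝ} {β : Matrix (Fin p) (Fin q) ℝ}
    {P B P' B' : Matrix (Fin n) (Fin q) ℝ} (hPB : IsAdmissible c P B)
    (hmin : ∀ θ' β', objective c X γ lam θ β + ρ / 2 * ‖scaledIndicator c * θ + (B - P)‖ ^ 2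
      ≤ objective c X γ lam θ' β' + ρ / 2 * ‖scaledIndicator c * θ' + (B - P)‖ ^ 2)
    (hP' : ∃ U D V, IsSVD (scaledIndicator c * θ + B) U D V ∧ P' = U * rectIdentity n q * Vᵀ)
    (hB' : B' = B + scaledIndicator c * θ - P') :
    IsAdmissible c P' B' ∧
      IsUpdate c X γ lam a θ β P (scaledIndicator c * θ + (B - P)) P' B' := by
  obtain ⟨⟨x, hx⟩, ⟨b, hb⟩, hP, hBn⟩ := hPB
  set R := scaledIndicator c * θ + (B - P) with hR
  have hM : scaledIndicator c * θ + B = P + R := by rw [hR]; abel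
  -- the test point with zero discriminant vectors
  have hobj : objective c X γ lam θ β + ρ / 2 * ‖R‖ ^ 2 ≤ n * a ^ 2 := by
    refine (hmin (x - b) 0).trans ?_
    have h1 : scaledIndicator c * (x - b) = P - B := by rw [Matrix.mul_sub, ← hx, ← hb]
    have h2 : ‖P - B‖ ≤ a := by
      refine (norm_sub_le _ _).trans ?_
      rw [ha, norm_of_orthonormal hP]
      linarith
    rw [objective, h1, Matrix.mul_zero, sub_zero, norm_indicatorMatrix_mul_sq, h1]
    have h3 : P - B + (B - P) = 0 := by abel
    have h4 : ‖P - B‖ ^ 2 ≤ a ^ 2 := by gcongr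
    have h5 : (n : ℝ) * ‖P - B‖ ^ 2 ≤ n * a ^ 2 := by gcongr
    simpa [h3] using h5
  have hJ := objective_nonneg c X hγ hlam θ β
  -- From `(ρ/2)‖R‖² ≤ n a² ≤ ρ/8`.
  have hRn : ‖R‖ ≤ 1 / 2 := by
    have h1 : ρ * ‖R‖ ^ 2 ≤ ρ * (1 / 2) ^ 2 := by linarith
    exact (sq_le_sq₀ (norm_nonneg _) (by norm_num)).1 (le_of_mul_le_mul_left h1 hρ)
  -- the polar factorization
  obtain ⟨U, D, V, hSVD, hPU⟩ := hP'
  obtain ⟨hP1, S, hS, hT, hMS⟩ := hSVD.exists_polar (le_of_orthonormal hP) hPU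
  have hBS : B' = P' * S := by
    rw [hB', add_comm B, hMS, Matrix.mul_add, Matrix.mul_one, add_sub_cancel_left]
  have hBn' : ‖B'‖ = ‖S‖ := by rw [hBS, frobenius_norm_mul_of_orthonormal hP1]
  have hTs : (1 + S)ᵀ = 1 + S := by rw [Matrix.transpose_add, hS, Matrix.transpose_one]
  -- `R` and `B'` are the displacements of the same matrix `P'(1 + S)` from `P` and from `P'`, so
  -- the gap identity compares their norms.
  have hgap := frobenius_norm_sub_sq_sub hP1 hP hTs
  have e1 : P' * (1 + S) - P = R := by rw [← hMS, hM, add_sub_cancel_left]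
  have e2 : P' * (1 + S) - P' = B' := by rw [hBS, Matrix.mul_add, Matrix.mul_one,
    add_sub_cancel_left]
  rw [e1, e2] at hgap
  have hBR : ‖B'‖ ≤ ‖R‖ := by
    have := posSemidef_frobeniusInner_nonneg hT (P' - P)
    exact (sq_le_sq₀ (norm_nonneg _) (norm_nonneg _)).1 (by linarith)
  have hSn : ‖S‖ ≤ 1 / 2 := by linarith
  -- Inverting `1 + S` writes `P'` as `Lθ + B` times a matrix on the right, which keeps its columns
  -- in the range of `L`.
  have hunit := isUnit_one_add_of_norm_lt_one (S := S) (by linarith)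
  have hPr : P' = (scaledIndicator c * θ + B) * (1 + S)⁻¹ := by
    rw [hMS, Matrix.mul_assoc, Matrix.mul_nonsing_inv _ ((Matrix.isUnit_iff_isUnit_det _).1 hunit),
      Matrix.mul_one]
  have hPr' : P' = scaledIndicator c * ((θ + b) * (1 + S)⁻¹) := by
    rw [← Matrix.mul_assoc, Matrix.mul_add, ← hb, ← hPr]
  refine ⟨⟨⟨_, hPr'⟩, ⟨b + θ - (θ + b) * (1 + S)⁻¹, ?_⟩, hP1, hBR.trans hRn⟩,
    ⟨?_, hRn, hBR, ⟨S, hS, hBS, by rw [← hM, hMS]⟩, ?_⟩⟩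
  · rw [hB', Matrix.mul_sub, Matrix.mul_add, ← hb, ← hPr']
  · have : 0 ≤ ρ / 2 * ‖R‖ ^ 2 := by positivity
    linarith
  -- `‖S‖ ≤ 1/2` gives `⟨1 + S, AᵀA⟩ ≥ ½‖A‖²` with `A = P' - P`.
  · have h1 : frobeniusInner (1 + S) ((P' - P)ᵀ * (P' - P))
        = ‖P' - P‖ ^ 2 + frobeniusInner S ((P' - P)ᵀ * (P' - P)) := by
      rw [frobeniusInner_add_left, ← frobeniusInner_self (P' - P)]
      simp [frobeniusInner]
    have h2 := neg_le_frobeniusInner S ((P' - P)ᵀ * (P' - P))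
    have h3 : ‖S‖ * ‖(P' - P)ᵀ * (P' - P)‖ ≤ 1 / 2 * ‖P' - P‖ ^ 2 := by
      gcongr
      refine (Matrix.frobenius_norm_mul _ _).trans_eq ?_
      rw [Matrix.frobenius_norm_transpose, sq]
    linarith

/-- The change of the multiplier between two consecutive updates. -/
theorem IsUpdate.norm_sub_le {c : Fin n → Fin K} {X : Matrix (Fin n) (Fin p) ℝ}
    {γ lam a : ℝ} (ha : a = Real.sqrt q + 1 / 2) {θ θ' : Matrix (Fin K) (Fin q) ℝ}
    {β β' : Matrix (Fin p) (Fin q) ℝ} {P₀ P₁ P₂ R₁ R₂ B₁ B₂ : Matrix (Fin n) (Fin q) ℝ}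
    (hP₀ : P₀ᵀ * P₀ = 1) (hP₁ : P₁ᵀ * P₁ = 1) (hP₂ : P₂ᵀ * P₂ = 1)
    (h₁ : IsUpdate c X γ lam a θ β P₀ R₁ P₁ B₁) (h₂ : IsUpdate c X γ lam a θ' β' P₁ R₂ P₂ B₂) :
    ‖B₂ - B₁‖ ≤ 2 * a * ‖R₂ - R₁‖ + 2 * ‖R₁‖ * ‖P₁ - P₀‖ + ‖R₁‖ * ‖P₂ - P₁‖ := by
  obtain ⟨S₁, hS₁, hB₁, hM₁⟩ := h₁.polar
  obtain ⟨S₂, hS₂, hB₂, hM₂⟩ := h₂.polar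
  have n₁ : ‖B₁‖ = ‖S₁‖ := by rw [hB₁, frobenius_norm_mul_of_orthonormal hP₁]
  have n₂ : ‖B₂‖ = ‖S₂‖ := by rw [hB₂, frobenius_norm_mul_of_orthonormal hP₂]
  have hgram : ∀ {S : Matrix (Fin q) (Fin q) ℝ} {Q : Matrix (Fin n) (Fin q) ℝ},
      Qᵀ * Q = 1 → Sᵀ = S → (Q * (1 + S))ᵀ * (Q * (1 + S)) = (1 + S) * (1 + S) := by
    intro S Q hQ hS
    rw [Matrix.transpose_mul, Matrix.transpose_add, hS, Matrix.transpose_one, Matrix.mul_assoc,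
      ← Matrix.mul_assoc Qᵀ, hQ, Matrix.one_mul]
  have hSS : ‖S₂ - S₁‖ ≤ 2 * a * ‖R₂ - R₁‖ + 2 * ‖R₁‖ * ‖P₁ - P₀‖ := by
    refine (norm_sub_le_of_sq (S := S₁) (S' := S₂) ?_ ?_).trans ?_
    · rw [← n₁]; exact h₁.norm_B_le.trans h₁.norm_R
    · rw [← n₂]; exact h₂.norm_B_le.trans h₂.norm_R
    -- The squares `(1 + Sᵢ)²` are the Gram matrices of `P₀ + R₁` and `P₁ + R₂`, so the bound
    -- involves the preceding frames.
    rw [← hgram hP₂ hS₂, ← hgram hP₁ hS₁, ← hM₁, ← hM₂]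
    exact norm_gram_sub_le hP₀ hP₁ (by rw [norm_of_orthonormal hP₁, ha]) h₁.norm_R h₂.norm_R
  have hdec : B₂ - B₁ = P₂ * (S₂ - S₁) + (P₂ - P₁) * S₁ := by
    rw [hB₁, hB₂, Matrix.mul_sub, Matrix.sub_mul]
    abel
  rw [hdec]
  refine (norm_add_le _ _).trans ?_
  rw [frobenius_norm_mul_of_orthonormal hP₂]
  have h3 : ‖(P₂ - P₁) * S₁‖ ≤ ‖R₁‖ * ‖P₂ - P₁‖ := by
    refine (Matrix.frobenius_norm_mul _ _).trans ?_
    rw [mul_comm]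
    gcongr
    rw [← n₁]
    exact h₁.norm_B_le
  linarith

end DFSOS

/-! ### Descent sequences and the multiplier bound -/

namespace DFSOS

/-- A sequence bounded below with sufficient decrease converges, and the decrease tends to `0`. -/
theorem exists_tendsto_of_descent {Φ u : ℕ → ℝ} {b : ℝ} (hu : ∀ k, 0 ≤ u k)
    (hΦ : ∀ k, Φ (k + 1) ≤ Φ k - u k) (hb : ∀ k, b ≤ Φ k) :
    (∃ v, Tendsto Φ atTop (𝓝 v)) ∧ Tendsto u atTop (𝓝 0) := by
  have hanti : Antitone Φ := antitone_nat_of_succ_le fun k => by linarith [hu k, hΦ k]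
  have hlim := tendsto_atTop_ciInf hanti ⟨b, by rintro _ ⟨k, rfl⟩; exact hb k⟩
  refine ⟨⟨_, hlim⟩, ?_⟩
  have h := hlim.sub (hlim.comp (tendsto_add_atTop_nat 1))
  rw [sub_self] at h
  exact squeeze_zero hu (fun k => by simpa using by linarith [hΦ k]) h

theorem tendsto_zero_of_sq_le {E : Type*} [SeminormedAddCommGroup E] {f : ℕ → E} {u : ℕ → ℝ}
    {C : ℝ} (hC : 0 < C) (h : ∀ k, C * ‖f k‖ ^ 2 ≤ u k) (hu : Tendsto u atTop (𝓝 0)) :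
    Tendsto f atTop (𝓝 0) := by
  have h1 : Tendsto (fun k => ‖f k‖ ^ 2) atTop (𝓝 0) := by
    have h2 : Tendsto (fun k => u k / C) atTop (𝓝 (0 / C)) := hu.div_const C
    rw [zero_div] at h2
    exact squeeze_zero (fun k => sq_nonneg _)
      (fun k => (le_div_iff₀ hC).2 (by rw [mul_comm]; exact h k)) h2
  have h2 := h1.sqrt
  simp only [Real.sqrt_sq (norm_nonneg _), Real.sqrt_zero] at h2
  exact tendsto_zero_iff_norm_tendsto_zero.2 h2

namespace IsSequence

variable {n K p q : ℕ} {c : Fin n → Fin K} {X : Matrix (Fin n) (Fin p) ℝ} {γ lam ρ a κ : ℝ}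
  {θ : ℕ → Matrix (Fin K) (Fin q) ℝ} {β : ℕ → Matrix (Fin p) (Fin q) ℝ}
  {P B : ℕ → Matrix (Fin n) (Fin q) ℝ} {H : Matrix (Fin n) (Fin K) ℝ}

theorem isMinOn (hs : IsSequence c X γ lam ρ θ β P B) (k : ℕ) (θ' : Matrix (Fin K) (Fin q) ℝ)
    (β' : Matrix (Fin p) (Fin q) ℝ) :
    objective c X γ lam (θ (k + 1)) (β (k + 1))
        + ρ / 2 * ‖scaledIndicator c * θ (k + 1) + (B k - P k)‖ ^ 2
      ≤ objective c X γ lam θ' β' + ρ / 2 * ‖scaledIndicator c * θ' + (B k - P k)‖ ^ 2 := by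
  have h := hs.scores_step k (Set.mem_univ (θ', β'))
  simp only [Set.mem_ofPred_eq, sub_add_eq_add_sub] at h
  simpa only [add_sub_assoc] using h

theorem orthonormal_zero (hs : IsSequence c X γ lam ρ θ β P B) : (P 0)ᵀ * P 0 = 1 := by
  rw [hs.init_P, ← hs.init_feasible, Matrix.transpose_mul, Matrix.mul_assoc,
    ← Matrix.mul_assoc (scaledIndicator c)ᵀ, scaledIndicator_gram]
  simp [Matrix.mul_assoc]

theorem isAdmissible_and_isUpdate (hs : IsSequence c X γ lam ρ θ β P B) (hγ : 0 ≤ γ)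
    (hlam : 0 ≤ lam) (hρ : 0 < ρ) (ha : a = Real.sqrt q + 1 / 2) (hρa : 8 * n * a ^ 2 ≤ ρ)
    (k : ℕ) : IsAdmissible c (P k) (B k) ∧
      IsUpdate c X γ lam a (θ (k + 1)) (β (k + 1)) (P k)
        (scaledIndicator c * θ (k + 1) + (B k - P k)) (P (k + 1)) (B (k + 1)) := by
  have hstep : ∀ k, IsAdmissible c (P k) (B k) → _ := fun k hk =>
    hk.update c X hγ hlam hρ ha hρa (hs.isMinOn k) (hs.P_step k) (hs.B_step k)
  have hadm : IsAdmissible c (P k) (B k) := by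
    induction k with
    | zero =>
      exact ⟨⟨_, hs.init_P⟩, ⟨0, by rw [hs.init_B, Matrix.mul_zero]⟩, hs.orthonormal_zero,
        by rw [hs.init_B, norm_zero]; norm_num⟩
    | succ k ih => exact (hstep k ih).1
  exact ⟨hadm, (hstep k hadm).2⟩

theorem residual_eq (hs : IsSequence c X γ lam ρ θ β P B) (k : ℕ) :
    scaledIndicator c * θ (k + 1) - P (k + 1) = B (k + 1) - B k := by
  rw [hs.B_step k]
  abel

/-- The residual of the scores step is an explicit linear function of its minimizer. -/
theorem smul_shifted_residual (hs : IsSequence c X γ lam ρ θ β P B) (hγ : 0 ≤ γ)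
    (hlam : 0 ≤ lam) (hρ : 0 < ρ) (ha : a = Real.sqrt q + 1 / 2) (hρa : 8 * n * a ^ 2 ≤ ρ)
    (hH : H * ((scaledIndicator c)ᵀ * scaledIndicator c) = scaledIndicator c) (k : ℕ) :
    scaledIndicator c * θ (k + 1) + (B k - P k)
      = ρ⁻¹ • -((2 : ℝ) • (H * ((indicatorMatrix c)ᵀ *
        (indicatorMatrix c * θ (k + 1) - X * β (k + 1))))) := by
  obtain ⟨x, hx⟩ := (hs.isAdmissible_and_isUpdate hγ hlam hρ ha hρa k).1.range_P
  obtain ⟨b, hb⟩ := (hs.isAdmissible_and_isUpdate hγ hlam hρ ha hρa k).1.range_B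
  have h := gradient_eq_zero_of_isMinOn c X hlam (hs.isMinOn k)
  -- The residual lies in the range of `L`, where `H Lᵀ` acts as the identity; applying `H` to the
  -- optimality condition therefore recovers it.
  have h1 : scaledIndicator c * θ (k + 1) + (B k - P k)
      = scaledIndicator c * (θ (k + 1) + (b - x)) := by
    rw [Matrix.mul_add, Matrix.mul_sub, ← hx, ← hb]
  rw [eq_inv_smul_iff₀ hρ.ne']
  have h2 := congrArg (H * ·) h
  simp only [Matrix.mul_smul, Matrix.mul_neg] at h2
  rw [← h2]
  nth_rw 2 [h1]
  rw [← Matrix.mul_assoc _ (scaledIndicator c), ← Matrix.mul_assoc, hH, ← h1]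

theorem norm_smul_mul_le (hκ : κ = 2 * ‖H‖ * ‖indicatorMatrix c‖) (hρ : 0 < ρ)
    (E : Matrix (Fin n) (Fin q) ℝ) :
    ‖ρ⁻¹ • -((2 : ℝ) • (H * ((indicatorMatrix c)ᵀ * E)))‖ ≤ κ / ρ * ‖E‖ := by
  have h1 : ‖H * ((indicatorMatrix c)ᵀ * E)‖ ≤ ‖H‖ * (‖indicatorMatrix c‖ * ‖E‖) := by
    refine (Matrix.frobenius_norm_mul _ _).trans ?_
    gcongr
    exact (Matrix.frobenius_norm_mul _ _).trans_eq (by rw [Matrix.frobenius_norm_transpose])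
  rw [norm_smul, norm_neg, norm_smul, Real.norm_of_nonneg (inv_nonneg.2 hρ.le), Real.norm_two]
  calc ρ⁻¹ * (2 * ‖H * ((indicatorMatrix c)ᵀ * E)‖)
      ≤ ρ⁻¹ * (2 * (‖H‖ * (‖indicatorMatrix c‖ * ‖E‖))) := by gcongr
    _ = κ / ρ * ‖E‖ := by rw [hκ]; ring

/-- The change of the multiplier is of order `1 / ρ`. -/
theorem norm_B_sub_le (hs : IsSequence c X γ lam ρ θ β P B) (hγ : 0 ≤ γ)
    (hlam : 0 ≤ lam) (hρ : 0 < ρ) (ha : a = Real.sqrt q + 1 / 2) (hρa : 8 * n * a ^ 2 ≤ ρ)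
    (hH : H * ((scaledIndicator c)ᵀ * scaledIndicator c) = scaledIndicator c)
    (hκ : κ = 2 * ‖H‖ * ‖indicatorMatrix c‖) (k : ℕ) :
    ‖B (k + 2) - B (k + 1)‖ ≤ (2 * a * κ + 2 * (κ * Real.sqrt (n * a ^ 2))) / ρ *
      (‖indicatorMatrix c * (θ (k + 2) - θ (k + 1)) - X * (β (k + 2) - β (k + 1))‖
        + ‖P (k + 1) - P k‖ + ‖P (k + 2) - P (k + 1)‖) := by
  obtain ⟨a₀, u₀⟩ := hs.isAdmissible_and_isUpdate hγ hlam hρ ha hρa k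
  obtain ⟨a₁, u₁⟩ := hs.isAdmissible_and_isUpdate hγ hlam hρ ha hρa (k + 1)
  have a₂ := (hs.isAdmissible_and_isUpdate hγ hlam hρ ha hρa (k + 2)).1
  have h := IsUpdate.norm_sub_le ha a₀.orthonormal a₁.orthonormal a₂.orthonormal u₀ u₁
  have r₀ := hs.smul_shifted_residual hγ hlam hρ ha hρa hH k
  have r₁ := hs.smul_shifted_residual hγ hlam hρ ha hρa hH (k + 1)
  set E₀ := indicatorMatrix c * θ (k + 1) - X * β (k + 1) with hE₀
  set R₀ := scaledIndicator c * θ (k + 1) + (B k - P k)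
  set R₁ := scaledIndicator c * θ (k + 1 + 1) + (B (k + 1) - P (k + 1))
  set w := ‖indicatorMatrix c * (θ (k + 2) - θ (k + 1)) - X * (β (k + 2) - β (k + 1))‖
  set s := Real.sqrt (n * a ^ 2)
  have ha0 : 0 ≤ a := by rw [ha]; positivity
  have hκ0 : 0 ≤ κ := by rw [hκ]; positivity
  have hs0 : 0 ≤ s := Real.sqrt_nonneg _
  have hE₀n : ‖E₀‖ ≤ s := by
    refine Real.le_sqrt_of_sq_le (le_trans ?_ u₀.objective_le)
    refine le_trans ?_ (sq_norm_add_le_objective c X hlam _ _)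
    have : 0 ≤ γ * ‖β (k + 1)‖ ^ 2 := by positivity
    linarith
  have hR₀ : ‖R₀‖ ≤ κ * s / ρ := by
    rw [r₀]
    refine (norm_smul_mul_le hκ hρ _).trans ?_
    rw [mul_div_right_comm]
    gcongr
  have hR : ‖R₁ - R₀‖ ≤ κ / ρ * w := by
    have e : R₁ - R₀ = ρ⁻¹ • -((2 : ℝ) • (H * ((indicatorMatrix c)ᵀ *
        (indicatorMatrix c * (θ (k + 2) - θ (k + 1)) - X * (β (k + 2) - β (k + 1)))))) := by
      have hE : indicatorMatrix c * (θ (k + 2) - θ (k + 1)) - X * (β (k + 2) - β (k + 1))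
          = (indicatorMatrix c * θ (k + 1 + 1) - X * β (k + 1 + 1)) - E₀ := by
        simp only [hE₀, Matrix.mul_sub]
        abel
      rw [hE, r₀, r₁]
      generalize indicatorMatrix c * θ (k + 1 + 1) - X * β (k + 1 + 1) = E₁
      clear_value E₀
      rw [Matrix.mul_sub, Matrix.mul_sub]
      simp only [smul_sub, smul_neg]
      abel
    rw [e]
    exact norm_smul_mul_le hκ hρ _
  refine h.trans ?_
  have i1 : 2 * a * ‖R₁ - R₀‖ ≤ 2 * a * (κ / ρ * w) := by gcongr
  have i2 : 2 * ‖R₀‖ * ‖P (k + 1) - P k‖ ≤ 2 * (κ * s / ρ) * ‖P (k + 1) - P k‖ := by gcongr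
  have i3 : ‖R₀‖ * ‖P (k + 1 + 1) - P (k + 1)‖ ≤ κ * s / ρ * ‖P (k + 2) - P (k + 1)‖ := by gcongr
  have j1 : 0 ≤ κ * s / ρ := by positivity
  have j2 : 0 ≤ a * κ / ρ := by positivity
  have j3 : 0 ≤ w := norm_nonneg _
  have e : (2 * a * κ + 2 * (κ * s)) / ρ = 2 * (a * κ / ρ) + 2 * (κ * s / ρ) := by ring
  have e1 : 2 * a * (κ / ρ * w) = 2 * (a * κ / ρ) * w := by ring
  rw [e]
  rw [e1] at i1
  have k1 := mul_nonneg j1 j3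
  have k2 := mul_nonneg j1 (norm_nonneg (P (k + 1) - P k))
  have k3 := mul_nonneg j1 (norm_nonneg (P (k + 2) - P (k + 1)))
  have k4 := mul_nonneg j2 (norm_nonneg (P (k + 1) - P k))
  have k5 := mul_nonneg j2 (norm_nonneg (P (k + 2) - P (k + 1)))
  linarith

end IsSequence

end DFSOS

/-! ### Sufficient decrease, limit points and boundedness -/

namespace DFSOS.IsSequence

variable {n K p q : ℕ} {c : Fin n → Fin K} {X : Matrix (Fin n) (Fin p) ℝ} {γ lam ρ a κ C : ℝ}
  {θ : ℕ → Matrix (Fin K) (Fin q) ℝ} {β : ℕ → Matrix (Fin p) (Fin q) ℝ}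
  {P B : ℕ → Matrix (Fin n) (Fin q) ℝ} {H : Matrix (Fin n) (Fin K) ℝ}

/-- The decrease of the augmented Lagrangian in one iteration, up to the change of the
multiplier. -/
theorem lagrangian_descent (hs : IsSequence c X γ lam ρ θ β P B) (hγ : 0 ≤ γ)
    (hlam : 0 ≤ lam) (hρ : 0 < ρ) (ha : a = Real.sqrt q + 1 / 2) (hρa : 8 * n * a ^ 2 ≤ ρ)
    (k : ℕ) :
    objective c X γ lam (θ (k + 1)) (β (k + 1))
        + ρ / 2 * ‖scaledIndicator c * θ (k + 1) + (B (k + 1) - P (k + 1))‖ ^ 2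
        - ρ / 2 * ‖B (k + 1)‖ ^ 2
      ≤ objective c X γ lam (θ k) (β k) + ρ / 2 * ‖scaledIndicator c * θ k + (B k - P k)‖ ^ 2
        - ρ / 2 * ‖B k‖ ^ 2
        - (‖indicatorMatrix c * (θ (k + 1) - θ k) - X * (β (k + 1) - β k)‖ ^ 2
          + γ * ‖β (k + 1) - β k‖ ^ 2)
        - ρ / 4 * ‖P (k + 1) - P k‖ ^ 2 + ρ * ‖B (k + 1) - B k‖ ^ 2 := by
  have hu := (hs.isAdmissible_and_isUpdate hγ hlam hρ ha hρa k).2.descent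
  -- The growth inequality is read from the new minimizer back to the old iterate.
  have h1 := objective_ge_of_isMinOn c X hlam (hs.isMinOn k) (θ k - θ (k + 1)) (β k - β (k + 1))
  have h2 : indicatorMatrix c * (θ k - θ (k + 1)) - X * (β k - β (k + 1))
      = -(indicatorMatrix c * (θ (k + 1) - θ k) - X * (β (k + 1) - β k)) := by
    simp only [Matrix.mul_sub]
    abel
  rw [add_sub_cancel, add_sub_cancel, h2, norm_neg, norm_sub_rev (β k)] at h1
  have h3 : scaledIndicator c * θ k + (B k - P k)
      = (scaledIndicator c * θ (k + 1) + (B k - P k))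
        + scaledIndicator c * (θ k - θ (k + 1)) := by
    rw [Matrix.mul_sub]
    abel
  have h4 : scaledIndicator c * θ (k + 1) + (B (k + 1) - P (k + 1))
      = (B (k + 1) - B k) + B (k + 1) := by
    rw [← hs.residual_eq k]
    abel
  -- The cross terms `⟨ΔB, B (k + 1)⟩` from this expansion and from the new residual cancel, leaving
  -- exactly `ρ‖ΔB‖²`.
  have h5 : ‖B k‖ ^ 2 = ‖B (k + 1) - B k‖ ^ 2
      - 2 * frobeniusInner (B (k + 1) - B k) (B (k + 1)) + ‖B (k + 1)‖ ^ 2 := by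
    rw [← frobenius_norm_sub_sq, sub_sub_cancel_left, norm_neg]
  rw [h3, h4, frobenius_norm_add_sq (scaledIndicator c * θ (k + 1) + (B k - P k)),
    frobenius_norm_add_sq (B (k + 1) - B k), h5]
  have h6 : 0 ≤ ρ * ‖scaledIndicator c * (θ k - θ (k + 1))‖ ^ 2 := by positivity
  have h7 := mul_le_mul_of_nonneg_left hu hρ.le
  linarith

/-- Sufficient decrease makes the successive differences tend to `0` and the objective converge. -/
theorem tendsto_sub_zero (hs : IsSequence c X γ lam ρ θ β P B) (hγ : 0 < γ)
    (hlam : 0 ≤ lam) (ha : a = Real.sqrt q + 1 / 2)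
    (hH : H * ((scaledIndicator c)ᵀ * scaledIndicator c) = scaledIndicator c)
    (hκ : κ = 2 * ‖H‖ * ‖indicatorMatrix c‖)
    (hC : C = 2 * a * κ + 2 * (κ * Real.sqrt (n * a ^ 2)))
    (hρ : 8 * n * a ^ 2 + 6 * C ^ 2 + 8 ≤ ρ) :
    Tendsto (fun k => indicatorMatrix c * (θ (k + 1) - θ k) - X * (β (k + 1) - β k)) atTop (𝓝 0) ∧
    Tendsto (fun k => β (k + 1) - β k) atTop (𝓝 0) ∧
    Tendsto (fun k => P (k + 1) - P k) atTop (𝓝 0) ∧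
    Tendsto (fun k => B (k + 1) - B k) atTop (𝓝 0) ∧
    ∃ v, Tendsto (fun k => objective c X γ lam (θ k) (β k)) atTop (𝓝 v) := by
  have hn0 : 0 ≤ 8 * n * a ^ 2 := by positivity
  have hC0 : 0 ≤ 6 * C ^ 2 := by positivity
  have hρ0 : 0 < ρ := by linarith
  have hρa : 8 * n * a ^ 2 ≤ ρ := by linarith
  set w : ℕ → Matrix (Fin n) (Fin q) ℝ :=
    fun k => indicatorMatrix c * (θ (k + 1) - θ k) - X * (β (k + 1) - β k)
  set F : ℕ → ℝ := fun k => objective c X γ lam (θ k) (β k)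
    + ρ / 2 * ‖scaledIndicator c * θ k + (B k - P k)‖ ^ 2 - ρ / 2 * ‖B k‖ ^ 2 with hF
  have hD : ∀ k, ‖B (k + 2) - B (k + 1)‖
      ≤ C / ρ * (‖w (k + 1)‖ + ‖P (k + 1) - P k‖ + ‖P (k + 2) - P (k + 1)‖) := by
    intro k
    rw [hC]
    exact hs.norm_B_sub_le hγ.le hlam hρ0 ha hρa hH hκ k
  have hD2 : ∀ k, ρ * ‖B (k + 2) - B (k + 1)‖ ^ 2
      ≤ 1 / 2 * (‖w (k + 1)‖ ^ 2 + ‖P (k + 1) - P k‖ ^ 2 + ‖P (k + 2) - P (k + 1)‖ ^ 2) := by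
    intro k
    set x := ‖w (k + 1)‖
    set y := ‖P (k + 1) - P k‖
    set z := ‖P (k + 2) - P (k + 1)‖
    have h1 : (x + y + z) ^ 2 ≤ 3 * (x ^ 2 + y ^ 2 + z ^ 2) := by
      nlinarith [sq_nonneg (x - y), sq_nonneg (y - z), sq_nonneg (x - z)]
    have h2 : C ^ 2 / ρ ≤ 1 / 6 := by
      rw [div_le_iff₀ hρ0]
      linarith
    calc ρ * ‖B (k + 2) - B (k + 1)‖ ^ 2 ≤ ρ * (C / ρ * (x + y + z)) ^ 2 := by
          gcongr
          exact hD k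
      _ = C ^ 2 / ρ * (x + y + z) ^ 2 := by field_simp
      _ ≤ 1 / 6 * (3 * (x ^ 2 + y ^ 2 + z ^ 2)) := by gcongr
      _ = _ := by ring
  -- The multiplier bound involves the previous change of `P`, so half its square joins the Lyapunov
  -- function. Of the coefficient `ρ/4 ≥ 2`, one half absorbs the multiplier term, one half pays for
  -- the new Lyapunov term, and `1` remains.
  have hdesc : ∀ k, F (k + 2) + 1 / 2 * ‖P (k + 2) - P (k + 1)‖ ^ 2
      ≤ F (k + 1) + 1 / 2 * ‖P (k + 1) - P k‖ ^ 2
        - (1 / 2 * ‖w (k + 1)‖ ^ 2 + γ * ‖β (k + 2) - β (k + 1)‖ ^ 2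
          + ‖P (k + 2) - P (k + 1)‖ ^ 2) := by
    intro k
    have h1 : F (k + 2) ≤ F (k + 1) - (‖w (k + 1)‖ ^ 2 + γ * ‖β (k + 2) - β (k + 1)‖ ^ 2)
        - ρ / 4 * ‖P (k + 2) - P (k + 1)‖ ^ 2 + ρ * ‖B (k + 2) - B (k + 1)‖ ^ 2 :=
      hs.lagrangian_descent hγ.le hlam hρ0 ha hρa (k + 1)
    have h2 := hD2 k
    have h3 : 2 * ‖P (k + 2) - P (k + 1)‖ ^ 2 ≤ ρ / 4 * ‖P (k + 2) - P (k + 1)‖ ^ 2 := by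
      gcongr
      linarith
    linarith
  have hBn : ∀ k, ‖B k‖ ≤ 1 / 2 := fun k =>
    (hs.isAdmissible_and_isUpdate hγ.le hlam hρ0 ha hρa k).1.norm_B
  have hbdd : ∀ k, -(ρ / 2 * (1 / 2) ^ 2) ≤ F (k + 1) + 1 / 2 * ‖P (k + 1) - P k‖ ^ 2 := by
    intro k
    have h1 := objective_nonneg c X hγ.le hlam (θ (k + 1)) (β (k + 1))
    have h2 : ρ / 2 * ‖B (k + 1)‖ ^ 2 ≤ ρ / 2 * (1 / 2) ^ 2 := by
      gcongr
      exact hBn _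
    have h3 : 0 ≤ ρ / 2 * ‖scaledIndicator c * θ (k + 1) + (B (k + 1) - P (k + 1))‖ ^ 2 := by
      positivity
    have h4 : 0 ≤ 1 / 2 * ‖P (k + 1) - P k‖ ^ 2 := by positivity
    simp only [hF]
    linarith
  obtain ⟨⟨v, hv⟩, hu⟩ := exists_tendsto_of_descent (fun k => by positivity) hdesc hbdd
  have hw0 : Tendsto w atTop (𝓝 0) := by
    refine (tendsto_add_atTop_iff_nat 1).1
      (tendsto_zero_of_sq_le (C := 1 / 2) (by norm_num) (fun k => ?_) hu)
    have : 0 ≤ γ * ‖β (k + 2) - β (k + 1)‖ ^ 2 := by positivity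
    have : 0 ≤ ‖P (k + 2) - P (k + 1)‖ ^ 2 := by positivity
    linarith
  have hβ0 : Tendsto (fun k => β (k + 1) - β k) atTop (𝓝 0) := by
    refine (tendsto_add_atTop_iff_nat 1).1
      (tendsto_zero_of_sq_le (C := γ) hγ (fun k => ?_) hu)
    have : 0 ≤ ‖w (k + 1)‖ ^ 2 := by positivity
    have : 0 ≤ ‖P (k + 2) - P (k + 1)‖ ^ 2 := by positivity
    linarith
  have hP0 : Tendsto (fun k => P (k + 1) - P k) atTop (𝓝 0) := by
    refine (tendsto_add_atTop_iff_nat 1).1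
      (tendsto_zero_of_sq_le (C := 1) one_pos (fun k => ?_) hu)
    have : 0 ≤ ‖w (k + 1)‖ ^ 2 := by positivity
    have : 0 ≤ γ * ‖β (k + 2) - β (k + 1)‖ ^ 2 := by positivity
    linarith
  have hPn := tendsto_zero_iff_norm_tendsto_zero.1 hP0
  have hwn := tendsto_zero_iff_norm_tendsto_zero.1 hw0
  have hB0 : Tendsto (fun k => B (k + 1) - B k) atTop (𝓝 0) := by
    refine (tendsto_add_atTop_iff_nat 1).1 (squeeze_zero_norm hD ?_)
    have := (((hwn.comp (tendsto_add_atTop_nat 1)).add hPn).add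
      (hPn.comp (tendsto_add_atTop_nat 1))).const_mul (C / ρ)
    simpa using this
  refine ⟨hw0, hβ0, hP0, hB0, v, ?_⟩
  -- the penalty terms vanish in the limit
  have hFv : Tendsto (fun k => F (k + 1)) atTop (𝓝 v) := by
    have := hv.sub ((hPn.pow 2).const_mul (1 / 2))
    simpa using this
  have hBn0 := tendsto_zero_iff_norm_tendsto_zero.1 hB0
  -- `B` is bounded and its differences vanish.
  have hin : Tendsto (fun k => frobeniusInner (B (k + 1) - B k) (B (k + 1))) atTop (𝓝 0) := by
    refine squeeze_zero_norm (a := fun k => ‖B (k + 1) - B k‖ * (1 / 2)) (fun k => ?_) ?_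
    · rw [Real.norm_eq_abs, abs_le]
      have h1 : ‖B (k + 1) - B k‖ * ‖B (k + 1)‖ ≤ ‖B (k + 1) - B k‖ * (1 / 2) := by
        gcongr
        exact hBn _
      exact ⟨by linarith [neg_le_frobeniusInner (B (k + 1) - B k) (B (k + 1))],
        by linarith [frobeniusInner_le (B (k + 1) - B k) (B (k + 1))]⟩
    · simpa only [zero_mul] using hBn0.mul_const (1 / 2 : ℝ)
  refine (tendsto_add_atTop_iff_nat 1).1 ?_
  have hlim := (hFv.sub ((hBn0.pow 2).const_mul (ρ / 2))).sub (hin.const_mul ρ)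
  simp only [mul_zero, ne_eq, OfNat.ofNat_ne_zero, not_false_eq_true, zero_pow, sub_zero] at hlim
  refine hlim.congr fun k => ?_
  have h4 : scaledIndicator c * θ (k + 1) + (B (k + 1) - P (k + 1))
      = (B (k + 1) - B k) + B (k + 1) := by
    rw [← hs.residual_eq k]
    abel
  simp only [hF]
  rw [h4, frobenius_norm_add_sq (B (k + 1) - B k)]
  ring

theorem continuous_penalized (c : Fin n → Fin K) (X : Matrix (Fin n) (Fin p) ℝ) (γ lam ρ : ℝ) :
    Continuous (fun z : (Matrix (Fin K) (Fin q) ℝ × Matrix (Fin p) (Fin q) ℝ) ×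
        Matrix (Fin n) (Fin q) ℝ =>
      objective c X γ lam z.1.1 z.1.2 + ρ / 2 * ‖scaledIndicator c * z.1.1 + z.2‖ ^ 2) :=
  ((continuous_objective c X γ lam).comp continuous_fst).add (by fun_prop)

/-- Every limit point of the primal iterates is stationary. -/
theorem exists_tendsto_and_stationary (hs : IsSequence c X γ lam ρ θ β P B) (hγ : 0 ≤ γ)
    (hlam : 0 ≤ lam) (hρ : 0 < ρ) (ha : a = Real.sqrt q + 1 / 2) (hρa : 8 * n * a ^ 2 ≤ ρ)
    (hH : H * ((scaledIndicator c)ᵀ * scaledIndicator c) = scaledIndicator c)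
    (hP0 : Tendsto (fun k => P (k + 1) - P k) atTop (𝓝 0))
    (hB0 : Tendsto (fun k => B (k + 1) - B k) atTop (𝓝 0))
    {φ : ℕ → ℕ} (hφ : Tendsto φ atTop atTop) {θs : Matrix (Fin K) (Fin q) ℝ}
    {βs : Matrix (Fin p) (Fin q) ℝ}
    (hlim : Tendsto (fun j => (θ (φ j), β (φ j))) atTop (𝓝 (θs, βs))) :
    ∃ Ps Bs : Matrix (Fin n) (Fin q) ℝ, Tendsto (fun j => P (φ j)) atTop (𝓝 Ps) ∧
      Tendsto (fun j => B (φ j)) atTop (𝓝 Bs) ∧ Ps = scaledIndicator c * θs ∧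
      0 ∈ limitingSubdifferential (augmentedLagrangian c X γ lam ρ Bs) (θs, βs, Ps) := by
  have hfacts := hs.isAdmissible_and_isUpdate hγ hlam hρ ha hρa
  -- The scores step at index `φ j` uses `P` and `B` at the preceding index; truncated subtraction
  -- is harmless once `φ j ≥ 1`.
  have hφ1 : ∀ᶠ j in atTop, φ j - 1 + 1 = φ j := by
    filter_upwards [hφ.eventually_ge_atTop 1] with j hj using Nat.sub_add_cancel hj
  have hψ : Tendsto (fun j => φ j - 1) atTop atTop := (tendsto_sub_atTop_nat 1).comp hφ
  have hcont : ∀ {f : Matrix (Fin K) (Fin q) ℝ × Matrix (Fin p) (Fin q) ℝ →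
      Matrix (Fin n) (Fin q) ℝ}, Continuous f →
      Tendsto (fun j => f (θ (φ j), β (φ j))) atTop (𝓝 (f (θs, βs))) := fun hf =>
    (hf.tendsto _).comp hlim
  have hPψ : Tendsto (fun j => P (φ j) - P (φ j - 1)) atTop (𝓝 0) :=
    (hP0.comp hψ).congr' (hφ1.mono fun j hj => by simp [hj])
  have hBψ : Tendsto (fun j => B (φ j) - B (φ j - 1)) atTop (𝓝 0) :=
    (hB0.comp hψ).congr' (hφ1.mono fun j hj => by simp [hj])
  set Ps := scaledIndicator c * θs with hPs
  set Bs := ρ⁻¹ • -((2 : ℝ) • (H * ((indicatorMatrix c)ᵀ *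
        (indicatorMatrix c * θs - X * βs)))) with hBs
  have hPlim : Tendsto (fun j => P (φ j)) atTop (𝓝 Ps) := by
    have h1 := (hcont (f := fun z => scaledIndicator c * z.1) (by fun_prop)).sub hBψ
    rw [sub_zero] at h1
    refine h1.congr' (hφ1.mono fun j hj => ?_)
    have h2 := hs.residual_eq (φ j - 1)
    rw [hj] at h2
    rw [← h2]
    abel
  -- `B (k + 1)` equals the residual of the scores step minus `P (k + 1) - P k`, and the residual is
  -- a continuous function of `(θ, β)`.
  have hBlim : Tendsto (fun j => B (φ j)) atTop (𝓝 Bs) := by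
    have h1 := (hcont (f := fun z => ρ⁻¹ • -((2 : ℝ) • (H * ((indicatorMatrix c)ᵀ *
        (indicatorMatrix c * z.1 - X * z.2))))) (by fun_prop)).sub hPψ
    rw [sub_zero] at h1
    refine h1.congr' (hφ1.mono fun j hj => ?_)
    have h2 := hs.smul_shifted_residual hγ hlam hρ ha hρa hH (φ j - 1)
    have h3 := hs.residual_eq (φ j - 1)
    rw [hj] at h2 h3
    dsimp only
    rw [← h2, ← sub_eq_zero]
    rw [← sub_eq_zero] at h3
    rw [← h3]
    abel
  have hP1lim : Tendsto (fun j => P (φ j - 1)) atTop (𝓝 Ps) := by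
    simpa using hPlim.sub hPψ
  have hB1lim : Tendsto (fun j => B (φ j - 1)) atTop (𝓝 Bs) := by
    simpa using hBlim.sub hBψ
  have hPB := hPlim.prodMk_nhds hBlim
  have hclosed : ∀ {l r : ℕ} {f g : Matrix (Fin n) (Fin q) ℝ × Matrix (Fin n) (Fin q) ℝ →
      Matrix (Fin l) (Fin r) ℝ}, Continuous f → Continuous g →
      (∀ k, f (P (k + 1), B (k + 1)) = g (P (k + 1), B (k + 1))) → f (Ps, Bs) = g (Ps, Bs) := by
    intro l r f g hf hg h
    refine tendsto_nhds_unique ((hf.tendsto _).comp hPB) (((hg.tendsto _).comp hPB).congr' ?_)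
    filter_upwards [hφ1] with j hj
    have := h (φ j - 1)
    rw [hj] at this
    exact this.symm
  -- Since `S = PᵀB`, symmetry of `S` and `B = PS` become closed conditions on `(P, B)`, so no limit
  -- of the factors `S` has to be extracted.
  have hpolar : ∀ k, ((P (k + 1))ᵀ * B (k + 1))ᵀ = (P (k + 1))ᵀ * B (k + 1) ∧
      B (k + 1) = P (k + 1) * ((P (k + 1))ᵀ * B (k + 1)) := by
    intro k
    obtain ⟨S, hS, hBS, -⟩ := (hfacts k).2.polar
    have h1 : (P (k + 1))ᵀ * B (k + 1) = S := by
      rw [hBS, ← Matrix.mul_assoc, (hfacts (k + 1)).1.orthonormal, Matrix.one_mul]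
    rw [h1]
    exact ⟨hS, hBS⟩
  refine ⟨Ps, Bs, hPlim, hBlim, rfl, ?_⟩
  refine zero_mem_limitingSubdifferential c X hγ hlam hρ (S := Psᵀ * Bs) ?_ rfl ?_ ?_ ?_
  · exact hclosed (f := fun z => z.1ᵀ * z.1) (g := fun _ => 1) (by fun_prop) (by fun_prop)
      fun k => (hfacts (k + 1)).1.orthonormal
  · exact hclosed (f := fun z => (z.1ᵀ * z.2)ᵀ) (g := fun z => z.1ᵀ * z.2) (by fun_prop)
      (by fun_prop) fun k => (hpolar k).1
  · exact hclosed (f := fun z => z.2) (g := fun z => z.1 * (z.1ᵀ * z.2)) (by fun_prop)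
      (by fun_prop) fun k => (hpolar k).2
  · intro θ' β'
    have hlim' := hlim.prodMk_nhds (hB1lim.sub hP1lim)
    have h1 := ((continuous_penalized c X γ lam ρ).tendsto _).comp hlim'
    have h2 := ((continuous_penalized c X γ lam ρ).tendsto _).comp
      ((tendsto_const_nhds (x := (θ', β'))).prodMk_nhds (hB1lim.sub hP1lim))
    refine le_of_tendsto_of_tendsto h1 h2 ?_
    filter_upwards [hφ1] with j hj
    have := hs.isMinOn (φ j - 1) θ' β'
    rwa [hj] at this

/-- `Lθ = P + ΔB` is bounded and `G Lᵀ` is a left inverse of `L`, while `γ‖β‖² ≤ J ≤ n a²` after the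
first step. The arbitrary `β 0` is bounded separately. -/
theorem isBounded_range (hs : IsSequence c X γ lam ρ θ β P B) (hγ : 0 < γ)
    (hlam : 0 ≤ lam) (hρ : 0 < ρ) (ha : a = Real.sqrt q + 1 / 2) (hρa : 8 * n * a ^ 2 ≤ ρ)
    {G : Matrix (Fin K) (Fin K) ℝ}
    (hG : G * ((scaledIndicator c)ᵀ * scaledIndicator c) = 1) :
    Bornology.IsBounded (Set.range fun k => (θ k, β k)) := by
  have hfacts := hs.isAdmissible_and_isUpdate hγ.le hlam hρ ha hρa
  have hL : ∀ k, ‖scaledIndicator c * θ k‖ ≤ a + 1 / 2 := by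
    rintro (_ | k)
    · rw [← hs.init_P, norm_of_orthonormal hs.orthonormal_zero]
      linarith
    · have h1 : scaledIndicator c * θ (k + 1) = P (k + 1) + (B (k + 1) - B k) := by
        rw [← hs.residual_eq k, add_sub_cancel]
      rw [h1]
      have h2 := norm_add_le (P (k + 1)) (B (k + 1) - B k)
      have h3 := norm_sub_le (B (k + 1)) (B k)
      have h4 := norm_of_orthonormal (hfacts (k + 1)).1.orthonormal
      linarith [(hfacts (k + 1)).1.norm_B, (hfacts k).1.norm_B]
  have hθ : ∀ k, ‖θ k‖ ≤ ‖G * (scaledIndicator c)ᵀ‖ * (a + 1 / 2) := by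
    intro k
    have h1 : θ k = G * (scaledIndicator c)ᵀ * (scaledIndicator c * θ k) := by
      rw [← Matrix.mul_assoc, Matrix.mul_assoc G, hG, Matrix.one_mul]
    rw [h1]
    refine (Matrix.frobenius_norm_mul _ _).trans ?_
    gcongr
    exact hL k
  have hβ : ∀ k, ‖β k‖ ≤ max ‖β 0‖ (Real.sqrt (n * a ^ 2 / γ)) := by
    rintro (_ | k)
    · exact le_max_left _ _
    · refine (Real.le_sqrt_of_sq_le ?_).trans (le_max_right _ _)
      rw [le_div_iff₀ hγ, mul_comm]
      refine le_trans (le_trans ?_ (sq_norm_add_le_objective c X hlam _ _)) (hfacts k).2.objective_le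
      have : 0 ≤ ‖indicatorMatrix c * θ (k + 1) - X * β (k + 1)‖ ^ 2 := by positivity
      linarith
  refine isBounded_iff_forall_norm_le.2
    ⟨max (‖G * (scaledIndicator c)ᵀ‖ * (a + 1 / 2)) (max ‖β 0‖ (Real.sqrt (n * a ^ 2 / γ))), ?_⟩
  rintro _ ⟨k, rfl⟩
  exact max_le_max (hθ k) (hβ k)

end DFSOS.IsSequence

theorem mainTheorem1 {n K p q : ℕ} (c : Fin n → Fin K) (hc : Function.Surjective c)
    (X : Matrix (Fin n) (Fin p) ℝ) (γ lam : ℝ) (hγ : 0 < γ) (hlam : 0 < lam) :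
    ∃ ρ₀ : ℝ, 0 < ρ₀ ∧ ∀ ρ : ℝ, ρ₀ ≤ ρ →
      ∀ (θ : ℕ → Matrix (Fin K) (Fin q) ℝ) (β : ℕ → Matrix (Fin p) (Fin q) ℝ)
        (P B : ℕ → Matrix (Fin n) (Fin q) ℝ),
        DFSOS.IsSequence c X γ lam ρ θ β P B →
        -- convergence to the set of stationary points, of the function values, of the residuals
        (Tendsto (fun k => Metric.infDist (θ k, β k, P k, B k)
            (DFSOS.stationarySet c X q γ lam ρ)) atTop (𝓝 0) ∧
          (∃ v : ℝ, Tendsto (fun k => DFSOS.objective c X γ lam (θ k) (β k)) atTop (𝓝 v)) ∧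
          Tendsto (fun k => ‖DFSOS.scaledIndicator c * θ k - P k‖) atTop (𝓝 0) ∧
          Tendsto (fun k => ‖(θ (k + 1), β (k + 1), P (k + 1), B (k + 1))
            - (θ k, β k, P k, B k)‖) atTop (𝓝 0)) ∧
        -- the iterates are bounded and have a limit point
        Bornology.IsBounded (Set.range fun k => (θ k, β k)) ∧
        (∃ (φ : ℕ → ℕ) (θs : Matrix (Fin K) (Fin q) ℝ) (βs : Matrix (Fin p) (Fin q) ℝ),
          StrictMono φ ∧ Tendsto (fun j => (θ (φ j), β (φ j))) atTop (𝓝 (θs, βs))) ∧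
        -- every limit point is stationary, with `P`, `B` converging along the same subsequence
        (∀ (φ : ℕ → ℕ) (θs : Matrix (Fin K) (Fin q) ℝ) (βs : Matrix (Fin p) (Fin q) ℝ),
          StrictMono φ → Tendsto (fun j => (θ (φ j), β (φ j))) atTop (𝓝 (θs, βs)) →
          ∃ Ps Bs : Matrix (Fin n) (Fin q) ℝ,
            Tendsto (fun j => P (φ j)) atTop (𝓝 Ps) ∧
            Tendsto (fun j => B (φ j)) atTop (𝓝 Bs) ∧
            Ps = DFSOS.scaledIndicator c * θs ∧
            0 ∈ limitingSubdifferential (DFSOS.augmentedLagrangian c X γ lam ρ Bs)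
              (θs, βs, Ps)) := by
  obtain ⟨G, hG⟩ := DFSOS.exists_mul_gram_eq_one hc
  set a : ℝ := Real.sqrt q + 1 / 2 with ha
  set H := DFSOS.scaledIndicator c * G with hHdef
  have hH : H * ((DFSOS.scaledIndicator c).transpose * DFSOS.scaledIndicator c)
      = DFSOS.scaledIndicator c := by
    rw [hHdef, Matrix.mul_assoc, hG, Matrix.mul_one]
  set κ : ℝ := 2 * ‖H‖ * ‖DFSOS.indicatorMatrix c‖ with hκ
  set C : ℝ := 2 * a * κ + 2 * (κ * Real.sqrt (n * a ^ 2)) with hC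
  have hn0 : 0 ≤ 8 * n * a ^ 2 := by positivity
  have hC0 : 0 ≤ 6 * C ^ 2 := by positivity
  -- The summands respectively give `‖R‖ ≤ 1/2`, `C²/ρ ≤ 1/6` in the multiplier bound, and `ρ/4 ≥ 2`
  -- in the descent.
  refine ⟨8 * n * a ^ 2 + 6 * C ^ 2 + 8, by positivity, ?_⟩
  intro ρ hρ θ β P B hs
  have hρ0 : 0 < ρ := by linarith
  have hρa : 8 * n * a ^ 2 ≤ ρ := by linarith
  obtain ⟨hw, hβ, hP, hB, v, hv⟩ := hs.tendsto_sub_zero hγ hlam.le ha hH hκ hC hρ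
  have hbdd := hs.isBounded_range hγ hlam.le hρ0 ha hρa hG
  have hstat : ∀ {φ : ℕ → ℕ}, Tendsto φ atTop atTop → ∀ {θs : Matrix (Fin K) (Fin q) ℝ}
      {βs : Matrix (Fin p) (Fin q) ℝ},
      Tendsto (fun j => (θ (φ j), β (φ j))) atTop (𝓝 (θs, βs)) → _ := fun hφ _ _ hlim =>
    hs.exists_tendsto_and_stationary hγ.le hlam.le hρ0 ha hρa hH hP hB hφ hlim
  -- The descent controls only `YΔθ - XΔβ` and `Δβ`; adding back `XΔβ` and applying the left inverse
  -- of `L` recovers `Δθ`.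
  have hθ : Tendsto (fun k => θ (k + 1) - θ k) atTop (𝓝 0) := by
    have hcont : Continuous fun z : Matrix (Fin n) (Fin q) ℝ × Matrix (Fin p) (Fin q) ℝ =>
        G * ((DFSOS.scaledIndicator c).transpose * ((1 / Real.sqrt n) • (z.1 + X * z.2))) := by
      fun_prop
    have h := (hcont.tendsto _).comp (hw.prodMk_nhds hβ)
    simp only [Matrix.mul_zero, add_zero, smul_zero] at h
    refine h.congr fun k => ?_
    simp only [Function.comp_apply]
    rw [sub_add_cancel, ← Matrix.smul_mul]
    change G * ((DFSOS.scaledIndicator c).transpose * (DFSOS.scaledIndicator c * _)) = _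
    rw [← Matrix.mul_assoc _ (DFSOS.scaledIndicator c), ← Matrix.mul_assoc, hG, Matrix.one_mul]
  refine ⟨⟨?_, ⟨v, hv⟩, ?_, ?_⟩, hbdd, ?_, ?_⟩
  -- By boundedness every subsequence has a further one converging to a stationary point, whose
  -- membership also shows that the stationary set is nonempty.
  · refine tendsto_of_subseq_tendsto fun ns hns => ?_
    obtain ⟨⟨θs, βs⟩, -, φ, hφ, hlim⟩ :=
      tendsto_subseq_of_bounded hbdd (fun j => Set.mem_range_self (ns j))
    obtain ⟨Ps, Bs, hPs, hBs, hPθ, h0⟩ := hstat (hns.comp hφ.tendsto_atTop) hlim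
    refine ⟨φ, ?_⟩
    have hmem : (θs, βs, Ps, Bs) ∈ DFSOS.stationarySet c X q γ lam ρ := ⟨hPθ, h0⟩
    have hall := ((continuous_fst.tendsto _).comp hlim).prodMk_nhds
      (((continuous_snd.tendsto _).comp hlim).prodMk_nhds (hPs.prodMk_nhds hBs))
    exact squeeze_zero (fun _ => Metric.infDist_nonneg)
      (fun _ => Metric.infDist_le_dist_of_mem hmem) (tendsto_iff_dist_tendsto_zero.1 hall)
  · refine (tendsto_add_atTop_iff_nat 1).1 ?_
    exact (tendsto_zero_iff_norm_tendsto_zero.1 hB).congr fun k => by rw [hs.residual_eq]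
  · exact tendsto_zero_iff_norm_tendsto_zero.1
      (hθ.prodMk_nhds (hβ.prodMk_nhds (hP.prodMk_nhds hB)))
  · obtain ⟨⟨θs, βs⟩, -, φ, hφ, hlim⟩ :=
      tendsto_subseq_of_bounded hbdd (fun j => Set.mem_range_self j)
    exact ⟨φ, θs, βs, hφ, hlim⟩
  · intro φ θs βs hφ hlim
    exact hstat hφ.tendsto_atTop hlim
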